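/- Call $f:[0,\infty)\to[0,\infty)$ a \emph{dimension function} if it is non-decreasing and continuous with $f(0)=0$. For a dimension function $f$ and $A\subseteq\mathbb{R}^2$ let $$\mathcal{H}^f(A)=\sup_{\delta>0}\ \inf\Big\{\sum_i f(\operatorname{diam} U_i)\ :\ A\subseteq\bigcup_{i=1}^\infty U_i,\ \operatorname{diam} U_i<\delta\Big\}.$$ Let $\mathfrak g$, $\mathfrak h$ and $h$ be dimension functions, and suppose that $\mathfrak h$ is doubling, i.e. there is a constant $c>0$ with $\mathfrak h(2x)\le c\,\mathfrak h(x)$ for all $x\ge 0$. Let $E\subseteq\mathbb{R}^2$ be an $F_{\mathfrak h\mathfrak g}$-set, i.e. there is a subset $L$ of the unit circle with $\mathcal{H}^{\mathfrak g}(L)>0$ such that for each $e\in L$ there is a line segment $\ell_e$ in the direction $e$ with $\mathcal{H}^{\mathfrak h}(\ell_e\cap E)>0$. Suppose that $h\prec\mathfrak h^2\mathfrak g/\mathbf{id}$, i.e. $h(x)>0$ for all sufficiently small $x>0$ and $$\lim_{x\to0^+}\frac{\mathfrak h(x)^2\,\mathfrak g(x)}{x\,h(x)}=0 .$$ For $0<\delta\le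 1$ let $C(\delta)=\int_\delta^1\frac{\mathfrak g(u)}{u^2}\,du$. If $$\sum_{k\ge1}\sqrt{\frac{\mathfrak h(2^{-k})^2\,C(2^{-k+1})}{h(2^{-k})}}<\infty,$$ then $\mathcal{H}^h(E)>0$. -/

import Mathlib

open Filter Topology
open scoped NNReal ENNReal

/-- The Euclidean plane. -/
abbrev Plane : Type := EuclideanSpace ℝ (Fin 2)

/-- A dimension function: a non-decreasing continuous `h : [0, ∞) → [0, ∞)` with `h 0 = 0`. -/
structure IsDimensionFunction (h : ℝ≥0 → ℝ≥0) : Prop where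
  monotone : Monotone h
  continuous : Continuous h
  map_zero : h 0 = 0

/-- The doubling condition `h (2 x) ≤ C h (x)`. -/
def IsDoubling (h : ℝ≥0 → ℝ≥0) : Prop :=
  ∃ C : ℝ≥0, 0 < C ∧ ∀ x, h (2 * x) ≤ C * h x

/-- `g` is dimensionally smaller than `h`, that is `lim_{x → 0+} h x / g x = 0`;
the quotient is required to make sense, that is `g x ≠ 0`, for all small `x > 0`. -/
def DimSmaller (g h : ℝ≥0 → ℝ≥0) : Prop :=
  (∀ᶠ x in 𝓝[>] (0 : ℝ≥0), 0 < g x) ∧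
    Tendsto (fun x => h x / g x) (𝓝[>] (0 : ℝ≥0)) (𝓝 0)

/-- The generalized Hausdorff measure of a set `A` of the plane: the supremum over `δ > 0` of the
infimum of `∑ h (diam U_i)` over the countable coverings of `A` by sets of diameter at most `δ`
(see `MeasureTheory.Measure.mkMetric_apply`). The value of the gauge at infinite diameter plays no
role, because the supremum is approached as `δ → 0`. -/
noncomputable def genHausdorff (h : ℝ≥0 → ℝ≥0) (A : Set Plane) : ℝ≥0∞ :=
  MeasureTheory.Measure.mkMetric (fun d : ℝ≥0∞ => (h d.toNNReal : ℝ≥0∞)) A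

/-- `E` is a Furstenberg set of type `𝔥𝔤`: there is a set `L` of directions in the unit circle,
of positive `𝔤`-measure, such that for each `e ∈ L` some line segment in the direction of `e` meets
`E` in a set of positive `𝔥`-measure. -/
def IsFurstenberg (𝔥 𝔤 : ℝ≥0 → ℝ≥0) (E : Set Plane) : Prop :=
  ∃ L : Set Plane, L ⊆ Metric.sphere 0 1 ∧ 0 < genHausdorff 𝔤 L ∧
    ∀ e ∈ L, ∃ (x : Plane) (t : ℝ), 0 < t ∧
      0 < genHausdorff 𝔥 (segment ℝ x (x + t • e) ∩ E)

/-- `C(δ) = ∫_δ^1 𝔤(u) / u² du`, used for `0 < δ ≤ 1`. -/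
noncomputable def kakeyaConst (𝔤 : ℝ≥0 → ℝ≥0) (δ : ℝ) : ℝ :=
  ∫ u in δ..1, (𝔤 u.toNNReal : ℝ) / u ^ 2

/-! The proof is Córdoba's L² argument for the Kakeya maximal function, run at each dyadic scale and
combined with a pigeonholing over scales.

Countable subadditivity reduces to a set `G` of directions in one sector, of positive `𝔤`-content,
whose segments have bounded length and meet `E` in `𝔥`-content at least `ρ`. Cover `E` by small sets
and sort them by dyadic diameter. Since the series converges, thresholds `β * b k` with total below
`ρ` can be chosen, so every direction has a level `k` at which the sets of that level alone carry
content `β * b k` of its segment. Let `L k` be the directions captured at level `k`. The discrete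
Kakeya inequality `gaugePre_mul_sq_le`, in the form `gaugePre_mul_sq_le_card`, bounds the content of
`L k` times `(β * b k)²` by a constant times `𝔥(2^{-k-1})² C(2^{-k})` times the number of sets at
that level. As `b k` dominates the square root in the series, the content of `L k` is at most a
constant times the sum of `h (diam U)` over the level. Summing over `k` bounds the content of `G` by
the `h`-sum of the cover.

For the Kakeya inequality, slopes are cut into cells of length `δ`, and each cell is weighted by the
increment of the `𝔤`-content of `{slope ≤ x}`. Only subadditivity is needed: the weights telescope
to the content of `G`, and a run of cells of total length `x` weighs at most `D * 𝔤 x`. They thus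
replace a Frostman measure, and no measurability of the direction set enters. Segments whose slope
cells are `d` apart share `O(1 / (δ (d + 1)))` squares of side `δ`. Summation by parts against the
weights turns this kernel into `∫ 𝔤(u) / u² du`, and Cauchy–Schwarz (`sum_mul_sq_le_of_incidence`)
concludes. -/

/-- A weighted incidence bound: if every index of `s` is incident to at least `m₀` elements of `Q`
and the weighted number of common incidences is at most `H`, then `Q` is large. -/
theorem sum_mul_sq_le_of_incidence {ι κ : Type*} [DecidableEq κ] (s : Finset ι) (w : ι → ℝ)
    (hw : ∀ i ∈ s, 0 ≤ w i) (Q : Finset κ) (A : ι → Finset κ) (hA : ∀ i ∈ s, A i ⊆ Q)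
    {m₀ H : ℝ} (hm₀ : 0 ≤ m₀) (hm : ∀ i ∈ s, m₀ ≤ (A i).card) (hH0 : 0 ≤ H)
    (hH : ∀ i ∈ s, ∑ j ∈ s, w j * ((A i ∩ A j).card : ℝ) ≤ H) :
    (∑ i ∈ s, w i) * m₀ ^ 2 ≤ H * Q.card := by
  have hW : 0 ≤ ∑ i ∈ s, w i := Finset.sum_nonneg hw
  rcases hW.eq_or_lt with h0 | hpos
  · rw [← h0, zero_mul]; positivity
  have h1 : (∑ i ∈ s, w i) * m₀ ≤ ∑ i ∈ s, w i * (A i).card := by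
    rw [Finset.sum_mul]
    exact Finset.sum_le_sum fun i hi => mul_le_mul_of_nonneg_left (hm i hi) (hw i hi)
  have h2 : ∑ i ∈ s, w i * ((A i).card : ℝ) = ∑ q ∈ Q, ∑ i ∈ s, if q ∈ A i then w i else 0 := by
    rw [Finset.sum_comm]
    refine Finset.sum_congr rfl fun i hi => ?_
    rw [← Finset.sum_filter, Finset.filter_mem_eq_inter, Finset.inter_eq_right.2 (hA i hi),
      Finset.sum_const, nsmul_eq_mul, mul_comm]
  have h3 : (∑ q ∈ Q, ∑ i ∈ s, if q ∈ A i then w i else 0) ^ 2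
      ≤ Q.card * ∑ q ∈ Q, (∑ i ∈ s, if q ∈ A i then w i else 0) ^ 2 :=
    sq_sum_le_card_mul_sum_sq
  have h4 : ∑ q ∈ Q, (∑ i ∈ s, if q ∈ A i then w i else 0) ^ 2
      = ∑ i ∈ s, w i * ∑ j ∈ s, w j * ((A i ∩ A j).card : ℝ) := by
    simp_rw [sq, Finset.sum_mul_sum, Finset.mul_sum]
    rw [Finset.sum_comm]
    refine Finset.sum_congr rfl fun i hi => ?_
    rw [Finset.sum_comm]
    refine Finset.sum_congr rfl fun j hj => ?_
    have : ∀ q, ((if q ∈ A i then w i else 0) * if q ∈ A j then w j else 0)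
        = if q ∈ A i ∩ A j then w i * w j else 0 := by
      intro q
      by_cases h1 : q ∈ A i <;> by_cases h2 : q ∈ A j <;> simp [h1, h2]
    simp_rw [this]
    rw [← Finset.sum_filter, Finset.filter_mem_eq_inter,
      Finset.inter_eq_right.2 (Finset.inter_subset_left.trans (hA i hi)),
      Finset.sum_const, nsmul_eq_mul]
    ring
  have h5 : ∑ i ∈ s, w i * ∑ j ∈ s, w j * ((A i ∩ A j).card : ℝ) ≤ (∑ i ∈ s, w i) * H := by
    rw [Finset.sum_mul]
    exact Finset.sum_le_sum fun i hi => mul_le_mul_of_nonneg_left (hH i hi) (hw i hi)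
  have h6 : ((∑ i ∈ s, w i) * m₀) ^ 2 ≤ Q.card * ((∑ i ∈ s, w i) * H) := by
    calc ((∑ i ∈ s, w i) * m₀) ^ 2 ≤ (∑ i ∈ s, w i * (A i).card) ^ 2 := by gcongr
      _ ≤ _ := by
        rw [h2]
        refine h3.trans ?_
        rw [h4]
        gcongr
  have : (∑ i ∈ s, w i) * ((∑ i ∈ s, w i) * m₀ ^ 2) ≤ (∑ i ∈ s, w i) * (H * Q.card) := by
    nlinarith [h6]
  exact le_of_mul_le_mul_left this hpos

/-! ### The kernel `1 / (d + 1)` and the integral `C(δ)` -/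

/-- Summation by parts for the kernel `1 / (d + 1)`. -/
theorem inv_succ_le_sum_add (T d : ℕ) :
    (1 : ℝ) / (d + 1) ≤
      (∑ t ∈ Finset.range T, if d ≤ t then (1 : ℝ) / ((t + 1) * (t + 2)) else 0) + 1 / (T + 1) := by
  induction T with
  | zero =>
    simp only [Finset.range_zero, Finset.sum_empty, zero_add, Nat.cast_zero, div_one]
    rw [div_le_one (by positivity)]
    linarith [(Nat.cast_nonneg d : (0 : ℝ) ≤ d)]
  | succ T ih =>
    rw [Finset.sum_range_succ]
    by_cases h : d ≤ T
    · rw [if_pos h]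
      have : (1 : ℝ) / ((T + 1) * (T + 2)) + 1 / (((T + 1 : ℕ) : ℝ) + 1) = 1 / (T + 1) := by
        push_cast
        field_simp
        ring
      linarith
    · rw [if_neg h]
      have h0 : 0 ≤ ∑ t ∈ Finset.range T, if d ≤ t then (1 : ℝ) / ((t + 1) * (t + 2)) else 0 :=
        Finset.sum_nonneg fun t _ => by split_ifs <;> positivity
      have h1 : (1 : ℝ) / (d + 1) ≤ 1 / (((T + 1 : ℕ) : ℝ) + 1) := by
        gcongr
        omega
      linarith

theorem intervalIntegrable_div_sq {𝔤 : ℝ≥0 → ℝ≥0} (h𝔤 : IsDimensionFunction 𝔤) {a b : ℝ}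
    (ha : 0 < a) (hb : 0 < b) :
    IntervalIntegrable (fun u : ℝ => (𝔤 u.toNNReal : ℝ) / u ^ 2) MeasureTheory.volume a b := by
  apply ContinuousOn.intervalIntegrable
  have h1 : Continuous fun u : ℝ => (𝔤 u.toNNReal : ℝ) :=
    NNReal.continuous_coe.comp (h𝔤.continuous.comp continuous_real_toNNReal)
  refine h1.continuousOn.div (by fun_prop) fun x hx => ?_
  have : 0 < x := lt_of_lt_of_le (lt_min ha hb) hx.1
  positivity

theorem mul_le_integral_div_sq {𝔤 : ℝ≥0 → ℝ≥0} (h𝔤 : IsDimensionFunction 𝔤) {a b : ℝ}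
    (ha : 0 < a) (hab : a ≤ b) :
    (𝔤 a.toNNReal : ℝ) * (1 / a - 1 / b) ≤ ∫ u in a..b, (𝔤 u.toNNReal : ℝ) / u ^ 2 := by
  have hb : 0 < b := ha.trans_le hab
  have hne : ∀ x ∈ Set.uIcc a b, x ≠ 0 := fun x hx => (lt_of_lt_of_le (lt_min ha hb) hx.1).ne'
  have h1 : ∫ u in a..b, (𝔤 a.toNNReal : ℝ) / u ^ 2 = (𝔤 a.toNNReal : ℝ) * (1 / a - 1 / b) := by
    have : ∀ x ∈ Set.uIcc a b, HasDerivAt (fun u : ℝ => -((𝔤 a.toNNReal : ℝ) * u⁻¹))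
        ((𝔤 a.toNNReal : ℝ) / x ^ 2) x := by
      intro x hx
      have := ((hasDerivAt_inv (hne x hx)).const_mul (𝔤 a.toNNReal : ℝ)).neg
      refine this.congr_deriv ?_
      ring
    rw [intervalIntegral.integral_eq_sub_of_hasDerivAt this]
    · ring
    · refine ContinuousOn.intervalIntegrable (continuousOn_const.div (by fun_prop) fun x hx => ?_)
      exact pow_ne_zero 2 (hne x hx)
  rw [← h1]
  refine intervalIntegral.integral_mono_on hab ?_ (intervalIntegrable_div_sq h𝔤 ha hb) ?_
  · refine ContinuousOn.intervalIntegrable (continuousOn_const.div (by fun_prop) fun x hx => ?_)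
    exact pow_ne_zero 2 (hne x hx)
  · intro x hx
    have : (𝔤 a.toNNReal : ℝ) ≤ 𝔤 x.toNNReal :=
      NNReal.coe_le_coe.2 (h𝔤.monotone (Real.toNNReal_le_toNNReal hx.1))
    gcongr

theorem kakeyaConst_nonneg (𝔤 : ℝ≥0 → ℝ≥0) {δ : ℝ} (h : δ ≤ 1) : 0 ≤ kakeyaConst 𝔤 δ :=
  intervalIntegral.integral_nonneg h fun u _ => by positivity

/-- The interval `[1/2, 1]` alone contributes this much. It lets `C(δ)` absorb the total-mass term
left by summation by parts. -/
theorem apply_half_le_kakeyaConst {𝔤 : ℝ≥0 → ℝ≥0} (h𝔤 : IsDimensionFunction 𝔤) {δ : ℝ}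
    (h0 : 0 < δ) (h : δ ≤ 1 / 2) : (𝔤 (1 / 2) : ℝ) ≤ kakeyaConst 𝔤 δ := by
  have h1 := mul_le_integral_div_sq h𝔤 (a := 1 / 2) (b := 1) (by norm_num) (by norm_num)
  have h2 : (1 / 2 : ℝ).toNNReal = 1 / 2 := by
    rw [← NNReal.coe_inj, Real.coe_toNNReal _ (by norm_num)]; simp
  rw [h2] at h1
  have h3 : (0 : ℝ) ≤ ∫ u in δ..(1 / 2), (𝔤 u.toNNReal : ℝ) / u ^ 2 :=
    intervalIntegral.integral_nonneg h fun u _ => by positivity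
  have h4 := intervalIntegral.integral_add_adjacent_intervals
    (intervalIntegrable_div_sq h𝔤 h0 (by norm_num : (0 : ℝ) < 1 / 2))
    (intervalIntegrable_div_sq h𝔤 (by norm_num : (0 : ℝ) < 1 / 2) (by norm_num : (0 : ℝ) < 1))
  unfold kakeyaConst
  linarith

/-- A lower sum: for `u_t = (t + 1) / (T + 1)` the integral of `1 / u²` over `[u_t, u_{t+1}]` is
exactly `(T + 1) / ((t + 1) (t + 2))`, and `𝔤` is monotone. -/
theorem sum_le_kakeyaConst {𝔤 : ℝ≥0 → ℝ≥0} (h𝔤 : IsDimensionFunction 𝔤) (T : ℕ) :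
    ∑ t ∈ Finset.range T, (𝔤 (((t : ℝ) + 1) / (T + 1)).toNNReal : ℝ) *
      ((T + 1) * (1 / ((t + 1) * (t + 2)))) ≤ kakeyaConst 𝔤 (1 / (T + 1)) := by
  have hT : (0 : ℝ) < T + 1 := by positivity
  have key := intervalIntegral.sum_integral_adjacent_intervals
    (f := fun u : ℝ => (𝔤 u.toNNReal : ℝ) / u ^ 2) (μ := MeasureTheory.volume) (n := T)
    (a := fun t : ℕ => ((t : ℝ) + 1) / (T + 1))
    (fun k _ => intervalIntegrable_div_sq h𝔤 (by positivity) (by positivity))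
  have e1 : (((T : ℕ) : ℝ) + 1) / (T + 1) = 1 := div_self hT.ne'
  simp only [Nat.cast_zero, zero_add, e1] at key
  unfold kakeyaConst
  rw [← key]
  refine Finset.sum_le_sum fun t _ => ?_
  have := mul_le_integral_div_sq h𝔤 (a := ((t : ℝ) + 1) / (T + 1))
    (b := (((t + 1 : ℕ) : ℝ) + 1) / (T + 1)) (by positivity) (by gcongr; simp)
  refine le_trans (le_of_eq ?_) this
  congr 1
  push_cast
  field_simp
  ring

/-- The Kakeya-type kernel bound for the increments of a monotone sequence, sampled at scale
`1 / (T + 1)`, whose modulus of continuity is controlled by `𝔤`. -/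
theorem sum_increment_div_le {𝔤 : ℝ≥0 → ℝ≥0} (h𝔤 : IsDimensionFunction 𝔤) {T : ℕ} (hT : 1 ≤ T)
    {F : ℕ → ℝ} (hF : Monotone F) (hF0 : 0 ≤ F 0) {D : ℝ} (hD : 0 ≤ D)
    (hinc : ∀ a l : ℕ, l ≤ T + 1 → F (a + l) - F a ≤ D * 𝔤 ((l : ℝ) / (T + 1)).toNNReal)
    (htot : ∀ a, F a ≤ D * 𝔤 (1 / 2)) (M m : ℕ) :
    ∑ j ∈ Finset.range M, (F (j + 1) - F j) * ((T + 1) / ((Nat.dist m j : ℝ) + 1))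
      ≤ 3 * D * kakeyaConst 𝔤 (1 / (T + 1)) := by
  have hw : ∀ j, 0 ≤ F (j + 1) - F j := fun j => sub_nonneg.2 (hF j.le_succ)
  have hT0 : (0 : ℝ) < T + 1 := by positivity
  have hC : (𝔤 (1 / 2) : ℝ) ≤ kakeyaConst 𝔤 (1 / (T + 1)) := by
    refine apply_half_le_kakeyaConst h𝔤 (by positivity) ?_
    gcongr
    have : (1 : ℝ) ≤ T := by exact_mod_cast hT
    linarith
  have hball : ∀ t : ℕ, t + 1 ≤ T + 1 →
      ∑ j ∈ Finset.range M, (if Nat.dist m j ≤ t then F (j + 1) - F j else 0)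
        ≤ 2 * D * 𝔤 (((t : ℝ) + 1) / (T + 1)).toNNReal := by
    intro t ht
    rw [← Finset.sum_filter]
    have h1 : ∑ j ∈ Finset.range M with Nat.dist m j ≤ t, (F (j + 1) - F j)
        ≤ ∑ j ∈ Finset.Ico (m - t) (m + (t + 1)), (F (j + 1) - F j) := by
      refine Finset.sum_le_sum_of_subset_of_nonneg ?_ fun j _ _ => hw j
      intro j hj
      have hj' : m - j + (j - m) ≤ t := (Finset.mem_filter.1 hj).2
      rw [Finset.mem_Ico]
      omega
    rw [Finset.sum_Ico_sub F (by omega)] at h1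
    have h2 := hinc m (t + 1) ht
    -- The window around `m` is split at `m`, its left half being truncated at `0`. Each half has at
    -- most `t + 1` cells, whence the factor `2`.
    have h3 := hinc (m - t) (m - (m - t)) (by omega)
    have h4 : (𝔤 (((m - (m - t) : ℕ) : ℝ) / (T + 1)).toNNReal : ℝ)
        ≤ 𝔤 (((t : ℝ) + 1) / (T + 1)).toNNReal := by
      refine NNReal.coe_le_coe.2 (h𝔤.monotone (Real.toNNReal_le_toNNReal ?_))
      gcongr
      have : m - (m - t) ≤ t + 1 := by omega
      exact_mod_cast this
    rw [show m - t + (m - (m - t)) = m by omega] at h3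
    push_cast at h2
    have h5 := mul_le_mul_of_nonneg_left h4 hD
    linarith
  calc ∑ j ∈ Finset.range M, (F (j + 1) - F j) * ((T + 1) / ((Nat.dist m j : ℝ) + 1))
      ≤ ∑ j ∈ Finset.range M, (F (j + 1) - F j) * ((T + 1) *
        ((∑ t ∈ Finset.range T, if Nat.dist m j ≤ t then (1 : ℝ) / ((t + 1) * (t + 2)) else 0)
          + 1 / (T + 1))) := by
        refine Finset.sum_le_sum fun j _ => mul_le_mul_of_nonneg_left ?_ (hw j)
        rw [div_eq_mul_one_div]
        exact mul_le_mul_of_nonneg_left (inv_succ_le_sum_add T _) hT0.le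
    _ = (∑ t ∈ Finset.range T, (∑ j ∈ Finset.range M,
          if Nat.dist m j ≤ t then F (j + 1) - F j else 0) *
            ((T + 1) * (1 / ((t + 1) * (t + 2))))) + (F M - F 0) := by
        have : ∀ j, (F (j + 1) - F j) * ((T + 1) *
            ((∑ t ∈ Finset.range T, if Nat.dist m j ≤ t then (1 : ℝ) / ((t + 1) * (t + 2)) else 0)
              + 1 / (T + 1)))
            = (∑ t ∈ Finset.range T, (if Nat.dist m j ≤ t then F (j + 1) - F j else 0) *
                ((T + 1) * (1 / ((t + 1) * (t + 2))))) + (F (j + 1) - F j) := by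
          intro j
          rw [mul_add, mul_add, mul_one_div_cancel hT0.ne', mul_one, Finset.mul_sum, Finset.mul_sum]
          congr 1
          refine Finset.sum_congr rfl fun t _ => ?_
          split_ifs <;> ring
        simp_rw [this, Finset.sum_add_distrib, Finset.sum_range_sub, Finset.sum_mul]
        rw [Finset.sum_comm]
    _ ≤ (∑ t ∈ Finset.range T, (2 * D * 𝔤 (((t : ℝ) + 1) / (T + 1)).toNNReal) *
            ((T + 1) * (1 / ((t + 1) * (t + 2))))) + D * 𝔤 (1 / 2) := by
        refine add_le_add (Finset.sum_le_sum fun t ht => ?_) (by linarith [htot M])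
        exact mul_le_mul_of_nonneg_right
          (hball t (by have := Finset.mem_range.1 ht; omega)) (by positivity)
    -- The third multiple of `D` comes from the boundary term `1 / (T + 1)`, which telescoped to the
    -- total mass.
    _ ≤ 2 * D * kakeyaConst 𝔤 (1 / (T + 1)) + D * kakeyaConst 𝔤 (1 / (T + 1)) := by
        refine add_le_add ?_ (mul_le_mul_of_nonneg_left hC hD)
        simp_rw [mul_assoc (2 * D)]
        rw [← Finset.mul_sum]
        exact mul_le_mul_of_nonneg_left (sum_le_kakeyaConst h𝔤 T) (by positivity)
    _ = _ := by ring

/-! ### Contents at a fixed scale -/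

/-- The Hausdorff-type outer measure with gauge `h` built from covering sets of diameter at most
`r`. -/
noncomputable def gaugePre (h : ℝ≥0 → ℝ≥0) (r : ℝ≥0∞) : MeasureTheory.OuterMeasure Plane :=
  MeasureTheory.OuterMeasure.mkMetric'.pre
    (fun s : Set Plane => (h (Metric.ediam s).toNNReal : ℝ≥0∞)) r

theorem gaugePre_le (h : ℝ≥0 → ℝ≥0) {r : ℝ≥0∞} {s : Set Plane} (hs : Metric.ediam s ≤ r) :
    gaugePre h r s ≤ h (Metric.ediam s).toNNReal :=
  MeasureTheory.OuterMeasure.mkMetric'.pre_le hs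

theorem gaugePre_le_of_dist {h : ℝ≥0 → ℝ≥0} (hh : Monotone h) {r : ℝ≥0∞} {c : ℝ≥0} (hc : c ≤ r)
    {s : Set Plane} (hs : ∀ x ∈ s, ∀ y ∈ s, dist x y ≤ c) : gaugePre h r s ≤ h c := by
  have h1 : Metric.ediam s ≤ c := by
    refine Metric.ediam_le fun x hx y hy => ?_
    rw [edist_dist, ← ENNReal.ofReal_coe_nnreal]
    exact ENNReal.ofReal_le_ofReal (hs x hx y hy)
  refine (gaugePre_le h (h1.trans hc)).trans ?_
  exact ENNReal.coe_le_coe.2 (hh (ENNReal.toNNReal_mono ENNReal.coe_ne_top h1))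

theorem gaugePre_antitone (h : ℝ≥0 → ℝ≥0) {r r' : ℝ≥0∞} (hr : r ≤ r') (s : Set Plane) :
    gaugePre h r' s ≤ gaugePre h r s :=
  MeasureTheory.OuterMeasure.mkMetric'.mono_pre _ hr s

theorem genHausdorff_eq_iSup (h : ℝ≥0 → ℝ≥0) (s : Set Plane) :
    genHausdorff h s = ⨆ n : ℕ, gaugePre h (n : ℝ≥0∞)⁻¹ s := by
  unfold genHausdorff gaugePre
  rw [← MeasureTheory.OuterMeasure.coe_mkMetric, MeasureTheory.OuterMeasure.mkMetric,
    MeasureTheory.OuterMeasure.mkMetric'.eq_iSup_nat, MeasureTheory.OuterMeasure.iSup_apply]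

theorem exists_gaugePre_pos {h : ℝ≥0 → ℝ≥0} {s : Set Plane} (hs : 0 < genHausdorff h s) :
    ∃ n : ℕ, 0 < gaugePre h (n : ℝ≥0∞)⁻¹ s := by
  rw [genHausdorff_eq_iSup] at hs
  exact lt_iSup_iff.1 hs

/-! ### Plane geometry: slopes, sectors and grid squares -/

section Coordinates

variable {i j : Fin 2}

theorem plane_dist_sq (hij : i ≠ j) (x y : Plane) :
    dist x y ^ 2 = (x i - y i) ^ 2 + (x j - y j) ^ 2 := by
  rw [EuclideanSpace.dist_eq, Real.sq_sqrt (by positivity), Fin.sum_univ_two]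
  simp only [Real.dist_eq, sq_abs]
  fin_cases i <;> fin_cases j <;> simp at hij ⊢
  ring

theorem plane_norm_sq (hij : i ≠ j) (x : Plane) : ‖x‖ ^ 2 = x i ^ 2 + x j ^ 2 := by
  simpa using plane_dist_sq hij x 0

theorem plane_dist_le (hij : i ≠ j) (x y : Plane) : dist x y ≤ |x i - y i| + |x j - y j| := by
  refine abs_le_of_sq_le_sq' ?_ (by positivity) |>.2
  rw [plane_dist_sq hij, add_sq, sq_abs, sq_abs]
  have : 0 ≤ 2 * |x i - y i| * |x j - y j| := by positivity
  linarith

theorem abs_coord_sub_le_dist (i : Fin 2) (x y : Plane) : |x i - y i| ≤ dist x y := by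
  obtain ⟨j, hj⟩ : ∃ j : Fin 2, i ≠ j := ⟨i + 1, by fin_cases i <;> simp⟩
  refine abs_le_of_sq_le_sq ?_ dist_nonneg
  rw [plane_dist_sq hj]
  nlinarith [sq_nonneg (x j - y j)]

/-- The sector of unit vectors whose `i`-th coordinate has the sign of `s` and dominates the
`j`-th coordinate. -/
def sector (i j : Fin 2) (s : ℝ) : Set Plane := {e | ‖e‖ = 1 ∧ 0 < s * e i ∧ |e j| ≤ |e i|}

theorem abs_slope_le_one {s : ℝ} {e : Plane} (he : e ∈ sector i j s) : |e j / e i| ≤ 1 := by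
  rw [abs_div]
  exact div_le_one_of_le₀ he.2.2 (abs_nonneg _)

/-- With `θ` the angle between `e` and `f`, `sin θ` is up to sign the slope difference times `e i *
f i ≤ 1`. In a sector `cos θ ≥ 0`, so the squared chord `2 - 2 cos θ` is at most `2 sin² θ`. -/
theorem dist_le_two_mul_slope (hij : i ≠ j) {s : ℝ} {e f : Plane} (he : e ∈ sector i j s)
    (hf : f ∈ sector i j s) : dist e f ≤ 2 * |e j / e i - f j / f i| := by
  obtain ⟨he1, hes, hej⟩ := he
  obtain ⟨hf1, hfs, hfj⟩ := hf
  have hei : e i ≠ 0 := fun h => by simp [h] at hes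
  have hfi : f i ≠ 0 := fun h => by simp [h] at hfs
  have h1 := plane_norm_sq hij e
  have h2 := plane_norm_sq hij f
  rw [he1] at h1
  rw [hf1] at h2
  have hpos : 0 < e i * f i := by
    have h := mul_pos hes hfs
    have h' : 0 < s ^ 2 * (e i * f i) := by linarith
    exact pos_of_mul_pos_right h' (sq_nonneg s)
  have hle : |e j * f j| ≤ e i * f i := by
    rw [abs_mul, ← abs_of_pos hpos, abs_mul]
    exact mul_le_mul hej hfj (abs_nonneg _) (abs_nonneg _)
  have hle' := neg_le_of_abs_le hle
  have hcs : e i * f i ≤ 1 := by nlinarith [sq_nonneg (e i - f i), sq_nonneg (e j), sq_nonneg (f j)]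
  have hcos : e i * f i + e j * f j ≤ 1 := by
    nlinarith [sq_nonneg (e i - f i), sq_nonneg (e j - f j)]
  have hcross : (e i * f i + e j * f j) ^ 2 + (e j * f i - f j * e i) ^ 2 = 1 := by
    have : (e i * f i + e j * f j) ^ 2 + (e j * f i - f j * e i) ^ 2
      = (e i ^ 2 + e j ^ 2) * (f i ^ 2 + f j ^ 2) := by ring
    rw [this, ← h1, ← h2]; norm_num
  have hsl : e j * f i - f j * e i = (e i * f i) * (e j / e i - f j / f i) := by
    field_simp
  refine abs_le_of_sq_le_sq' ?_ (by positivity) |>.2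
  rw [mul_pow, sq_abs, plane_dist_sq hij]
  have h3 : (e j * f i - f j * e i) ^ 2 ≤ (e j / e i - f j / f i) ^ 2 := by
    rw [hsl, mul_pow]
    exact mul_le_of_le_one_left (sq_nonneg _) (pow_le_one₀ hpos.le hcs)
  nlinarith

theorem mem_sector_of_norm_eq_one {e : Plane} (he : ‖e‖ = 1) :
    ∃ i j : Fin 2, i ≠ j ∧ ∃ s : ℤ, e ∈ sector i j s := by
  have key : ∀ i j : Fin 2, i ≠ j → |e j| ≤ |e i| →
      ∃ s : ℤ, e ∈ sector i j s := by
    intro i j hij h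
    have hn := plane_norm_sq hij e
    have hi : e i ≠ 0 := by
      intro h0
      rw [h0, abs_zero] at h
      have : e j = 0 := abs_eq_zero.1 (le_antisymm h (abs_nonneg _))
      rw [he, h0, this] at hn
      norm_num at hn
    rcases hi.lt_or_gt with h0 | h0
    · exact ⟨-1, he, by push_cast; linarith, h⟩
    · exact ⟨1, he, by push_cast; linarith, h⟩
  rcases le_total |e 1| |e 0| with h | h
  · exact ⟨0, 1, by simp, key 0 1 (by simp) h⟩
  · exact ⟨1, 0, by simp, key 1 0 (by simp) h⟩

/-- The index of the square of side `η` containing a given point. -/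
noncomputable def cell (i j : Fin 2) (η : ℝ) (z : Plane) : ℤ × ℤ := (⌊z i / η⌋, ⌊z j / η⌋)

theorem abs_sub_lt_of_floor_eq {η a b : ℝ} (hη : 0 < η) (h : ⌊a / η⌋ = ⌊b / η⌋) :
    |a - b| < η := by
  have := Int.abs_sub_lt_one_of_floor_eq_floor h
  rwa [← sub_div, abs_div, abs_of_pos hη, div_lt_one hη] at this

theorem abs_floor_sub_le {η a b R : ℝ} (hη : 0 < η) (h : |a - b| ≤ R * η) :
    |((⌊a / η⌋ : ℤ) : ℝ) - (⌊b / η⌋ : ℤ)| ≤ R + 1 := by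
  have h1 : |a / η - b / η| ≤ R := by
    rwa [← sub_div, abs_div, abs_of_pos hη, div_le_iff₀ hη]
  have ha := Int.floor_le (a / η)
  have ha' := Int.lt_floor_add_one (a / η)
  have hb := Int.floor_le (b / η)
  have hb' := Int.lt_floor_add_one (b / η)
  rw [abs_le] at h1 ⊢
  constructor <;> linarith

theorem dist_le_of_cell_eq (hij : i ≠ j) {η : ℝ} (hη : 0 < η) {x y : Plane}
    (h : cell i j η x = cell i j η y) : dist x y ≤ 2 * η := by
  have h' := Prod.mk.inj h
  have h1 := abs_sub_lt_of_floor_eq hη h'.1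
  have h2 := abs_sub_lt_of_floor_eq hη h'.2
  linarith [plane_dist_le hij x y]

/-- The `3 × 3` block of squares around the square containing `z`. -/
noncomputable def cellBlock (i j : Fin 2) (η : ℝ) (z : Plane) : Finset (ℤ × ℤ) :=
  Finset.Icc ((cell i j η z).1 - 1) ((cell i j η z).1 + 1) ×ˢ
    Finset.Icc ((cell i j η z).2 - 1) ((cell i j η z).2 + 1)

theorem card_cellBlock (η : ℝ) (z : Plane) : (cellBlock i j η z).card = 9 := by
  have : ∀ a : ℤ, (a + 1 + 1 - (a - 1)).toNat = 3 := fun a => by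
    have : a + 1 + 1 - (a - 1) = 3 := by ring
    rw [this]; rfl
  simp [cellBlock, this]

theorem cell_mem_cellBlock {η : ℝ} (hη : 0 < η) {x z : Plane} (h : dist x z ≤ η) :
    cell i j η x ∈ cellBlock i j η z := by
  have key : ∀ k : Fin 2, ⌊x k / η⌋ ∈ Finset.Icc (⌊z k / η⌋ - 1) (⌊z k / η⌋ + 1) := by
    intro k
    have h1 : |x k - z k| ≤ η := (abs_coord_sub_le_dist k x z).trans h
    rw [abs_le] at h1
    rw [Finset.mem_Icc]
    constructor
    · rw [← Int.floor_sub_one]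
      apply Int.floor_le_floor
      rw [div_sub_one hη.ne']
      gcongr
      linarith
    · rw [← Int.floor_add_one]
      apply Int.floor_le_floor
      rw [div_add_one hη.ne']
      gcongr
      linarith
  exact Finset.mem_product.2 ⟨key i, key j⟩

/-- There are at most `R + 1` columns, and each holds at most two squares: its lowest one and the
one above. -/
theorem card_le_of_columns (S : Finset (ℤ × ℤ)) {R : ℝ} (hR : 0 ≤ R)
    (h1 : ∀ q ∈ S, ∀ q' ∈ S, |(q.1 : ℝ) - q'.1| ≤ R)
    (h2 : ∀ q ∈ S, ∀ q' ∈ S, q.1 = q'.1 → |q.2 - q'.2| ≤ 1) :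
    (S.card : ℝ) ≤ 2 * (R + 1) := by
  rcases S.eq_empty_or_nonempty with rfl | hne
  · simp; positivity
  obtain ⟨q₀, hq₀, hmin⟩ := S.exists_min_image Prod.fst hne
  have hcol : ∀ a ∈ S.image Prod.fst, (S.filter fun q => q.1 = a).card ≤ 2 := by
    intro a _
    rcases (S.filter fun q => q.1 = a).eq_empty_or_nonempty with h | hne'
    · simp [h]
    obtain ⟨q₁, hq₁, hmin₁⟩ := (S.filter fun q => q.1 = a).exists_min_image Prod.snd hne'
    have : (S.filter fun q => q.1 = a) ⊆ {(a, q₁.2), (a, q₁.2 + 1)} := by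
      intro q hq
      have hle := hmin₁ q hq
      rw [Finset.mem_filter] at hq hq₁
      have := abs_le.1 (h2 q hq.1 q₁ hq₁.1 (hq.2.trans hq₁.2.symm))
      obtain ⟨x, y⟩ := q
      simp only [Finset.mem_insert, Finset.mem_singleton, Prod.mk.injEq] at *
      omega
    exact (Finset.card_le_card this).trans Finset.card_le_two
  have himg : S.image Prod.fst ⊆ Finset.Icc q₀.1 (q₀.1 + ⌊R⌋) := by
    intro a ha
    obtain ⟨q, hq, rfl⟩ := Finset.mem_image.1 ha
    rw [Finset.mem_Icc]
    refine ⟨hmin q hq, ?_⟩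
    have : q.1 - q₀.1 ≤ ⌊R⌋ := by
      rw [Int.le_floor]
      push_cast
      exact (abs_le.1 (h1 q hq q₀ hq₀)).2
    linarith
  have hcard := Finset.card_le_mul_card_image S 2 hcol
  have hc2 := Finset.card_le_card himg
  rw [Int.card_Icc] at hc2
  have h3 : ((q₀.1 + ⌊R⌋ + 1 - q₀.1).toNat : ℝ) ≤ R + 1 := by
    have h0 : 0 ≤ ⌊R⌋ := Int.floor_nonneg.2 hR
    have : ((q₀.1 + ⌊R⌋ + 1 - q₀.1).toNat : ℤ) = ⌊R⌋ + 1 := by omega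
    have h' : ((q₀.1 + ⌊R⌋ + 1 - q₀.1).toNat : ℝ) = (⌊R⌋ : ℝ) + 1 := by exact_mod_cast this
    rw [h']
    linarith [Int.floor_le R]
  have h4 : (S.card : ℝ) ≤ 2 * ((S.image Prod.fst).card : ℝ) := by exact_mod_cast hcard
  have h5 : ((S.image Prod.fst).card : ℝ) ≤ R + 1 := le_trans (by exact_mod_cast hc2) h3
  linarith

/-- The number of squares met by two nearly straight sets of slopes `p` and `p'`. -/
theorem card_cells_le {η N p p' R : ℝ} (hη : 0 < η) (hp : |p| ≤ 1) (hp' : |p'| ≤ 1) (hR : 0 ≤ R)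
    {l l' : Set Plane} (hl : ∀ z ∈ l, ∀ y ∈ l, z j - y j = p * (z i - y i))
    (hlN : ∀ z ∈ l, ∀ y ∈ l, |z i - y i| ≤ N)
    (hl' : ∀ z ∈ l', ∀ y ∈ l', z j - y j = p' * (z i - y i))
    {S : Finset (ℤ × ℤ)} (hS : ∀ q ∈ S, ∃ z ∈ l, cell i j η z = q)
    (hS' : ∀ q ∈ S, ∃ z ∈ l', cell i j η z = q)
    (h : N ≤ R * η ∨ 4 * η ≤ |p - p'| * (R * η)) : (S.card : ℝ) ≤ 2 * (R + 2) := by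
  have := card_le_of_columns S (R := R + 1) (by positivity) ?_ ?_
  · linarith
  · intro q hq q' hq'
    obtain ⟨z, hz, hzq⟩ := hS q hq
    obtain ⟨y, hy, hyq⟩ := hS q' hq'
    obtain ⟨z', hz', hzq'⟩ := hS' q hq
    obtain ⟨y', hy', hyq'⟩ := hS' q' hq'
    have main : |z i - y i| ≤ R * η := by
      rcases h with h | h
      · exact (hlN z hz y hy).trans h
      have a1 := abs_sub_lt_of_floor_eq hη (Prod.mk.inj (hzq.trans hzq'.symm)).1
      have a2 := abs_sub_lt_of_floor_eq hη (Prod.mk.inj (hzq.trans hzq'.symm)).2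
      have a3 := abs_sub_lt_of_floor_eq hη (Prod.mk.inj (hyq.trans hyq'.symm)).1
      have a4 := abs_sub_lt_of_floor_eq hη (Prod.mk.inj (hyq.trans hyq'.symm)).2
      have b1 := hl z hz y hy
      have b2 := hl' z' hz' y' hy'
      -- Both lines pass through the squares of `z` and of `y`. Subtracting their equations bounds
      -- the horizontal extent of the common part by `4 * η / |p - p'|`.
      have e1 : (p - p') * (z i - y i)
          = (z j - z' j) - (y j - y' j) - p' * ((z i - z' i) - (y i - y' i)) := by
        linear_combination b2 - b1
      have b3 : |p' * ((z i - z' i) - (y i - y' i))| ≤ 2 * η := by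
        rw [abs_mul]
        calc |p'| * |(z i - z' i) - (y i - y' i)| ≤ 1 * |(z i - z' i) - (y i - y' i)| := by gcongr
          _ ≤ 2 * η := by rw [one_mul]; exact (abs_sub _ _).trans (by linarith)
      have b4 : |p - p'| * |z i - y i| ≤ 4 * η := by
        rw [← abs_mul, e1]
        refine (abs_sub _ _).trans ?_
        linarith [abs_sub (z j - z' j) (y j - y' j)]
      have hpp : 0 < |p - p'| := by
        rcases (abs_nonneg (p - p')).eq_or_lt with h0 | h0
        · rw [← h0] at h; linarith
        · exact h0
      exact le_of_mul_le_mul_left (b4.trans h) hpp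
    rw [← hzq, ← hyq]
    exact abs_floor_sub_le hη main
  · intro q hq q' hq' hqq
    obtain ⟨z, hz, hzq⟩ := hS q hq
    obtain ⟨y, hy, hyq⟩ := hS q' hq'
    have a1 : |z i - y i| < η := by
      rw [← hzq, ← hyq] at hqq
      exact abs_sub_lt_of_floor_eq hη hqq
    have a2 : |z j - y j| < η := by
      rw [hl z hz y hy, abs_mul]
      exact lt_of_le_of_lt (mul_le_of_le_one_left (abs_nonneg _) hp) a1
    have a3 : |z j / η - y j / η| < 1 := by
      rwa [← sub_div, abs_div, abs_of_pos hη, div_lt_one hη]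
    rw [← hzq, ← hyq]
    change |⌊z j / η⌋ - ⌊y j / η⌋| ≤ 1
    have c1 := Int.floor_le (z j / η)
    have c2 := Int.lt_floor_add_one (z j / η)
    have c3 := Int.floor_le (y j / η)
    have c4 := Int.lt_floor_add_one (y j / η)
    rw [abs_lt] at a3
    have d1 : ((⌊z j / η⌋ - ⌊y j / η⌋ : ℤ) : ℝ) < 2 := by push_cast; linarith
    have d2 : (-2 : ℝ) < ((⌊z j / η⌋ - ⌊y j / η⌋ : ℤ) : ℝ) := by push_cast; linarith
    have d1' : ⌊z j / η⌋ - ⌊y j / η⌋ < 2 := by exact_mod_cast d1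
    have d2' : -2 < ⌊z j / η⌋ - ⌊y j / η⌋ := by exact_mod_cast d2
    rw [abs_le]
    omega

/-- The content of the part of a sector whose slopes lie in a short interval. -/
theorem gaugePre_slope_le (hij : i ≠ j) {𝔤 : ℝ≥0 → ℝ≥0} (h𝔤 : Monotone 𝔤) {s : ℝ} {G : Set Plane}
    (hG : G ⊆ sector i j s) {r : ℝ≥0∞} {D : ℕ} (hD : 2 ≤ D) {a l l₀ : ℝ} (hl0 : 0 ≤ l₀)
    (hl : l / D ≤ l₀ / 2) (hDr : ENNReal.ofReal l₀ ≤ r) :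
    gaugePre 𝔤 r {e ∈ G | a < e j / e i ∧ e j / e i ≤ a + l} ≤ D * 𝔤 l₀.toNNReal := by
  -- The slope interval is chopped into `D` pieces of length `l / D`; each gives a set of directions
  -- of diameter at most `2 * (l / D) ≤ l₀ ≤ r`, hence admissible for the content.
  have hstep : ∀ k : ℕ, gaugePre 𝔤 r {e ∈ G | a < e j / e i ∧ e j / e i ≤ a + k * (l / D)}
      ≤ k * 𝔤 l₀.toNNReal := by
    intro k
    induction k with
    | zero =>
      have : {e ∈ G | a < e j / e i ∧ e j / e i ≤ a + (0 : ℕ) * (l / D)} = ∅ := by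
        ext e
        simp only [Nat.cast_zero, zero_mul, add_zero, Set.mem_empty_iff_false, iff_false]
        rintro ⟨_, h1, h2⟩
        exact h2.not_gt h1
      rw [this]; simp
    | succ k ih =>
      have hsub : {e ∈ G | a < e j / e i ∧ e j / e i ≤ a + (k + 1 : ℕ) * (l / D)} ⊆
          {e ∈ G | a < e j / e i ∧ e j / e i ≤ a + k * (l / D)} ∪
          {e ∈ G | a + k * (l / D) < e j / e i ∧ e j / e i ≤ a + (k + 1 : ℕ) * (l / D)} := by
        rintro e ⟨he, h1, h2⟩
        rcases le_or_gt (e j / e i) (a + k * (l / D)) with h | h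
        · exact Or.inl ⟨he, h1, h⟩
        · exact Or.inr ⟨he, h, h2⟩
      refine (MeasureTheory.measure_mono hsub).trans
        ((MeasureTheory.measure_union_le _ _).trans ?_)
      rw [show (((k + 1 : ℕ) : ℝ≥0∞) * 𝔤 l₀.toNNReal) = k * 𝔤 l₀.toNNReal + 𝔤 l₀.toNNReal by
        push_cast; ring]
      refine add_le_add ih (gaugePre_le_of_dist h𝔤 hDr ?_)
      rintro e ⟨he, h1, h2⟩ f ⟨hf, h3, h4⟩
      push_cast at h2 h4
      rw [add_mul, one_mul] at h2 h4
      refine (dist_le_two_mul_slope hij (hG he) (hG hf)).trans ?_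
      rw [Real.coe_toNNReal _ hl0]
      have : |e j / e i - f j / f i| ≤ l / D := by
        rw [abs_le]; constructor <;> linarith
      linarith
  have := hstep D
  have hD0 : (D : ℝ) ≠ 0 := by positivity
  rwa [mul_div_cancel₀ _ hD0] at this

end Coordinates

/-! ### The discrete Kakeya inequality -/

section Scale

variable {i j : Fin 2}

/-- The slope distribution function of a set of directions, sampled at scale `1 / (T + 1)`. -/
noncomputable def slopeDistribution (i j : Fin 2) (𝔤 : ℝ≥0 → ℝ≥0) (r : ℝ) (T : ℕ) (G : Set Plane)
    (m : ℕ) : ℝ :=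
  (gaugePre 𝔤 (ENNReal.ofReal r) {e ∈ G | e j / e i ≤ -2 + (m : ℝ) / (T + 1)}).toReal

/-- All slopes lie in `(-2, 2]`. Chopping this interval with `l₀ = min (1/2) r` needs `4 / D ≤ l₀ /
2`, which is the origin of `16 ≤ D` and `8 / r ≤ D`. -/
theorem gaugePre_sector_le (hij : i ≠ j) {𝔤 : ℝ≥0 → ℝ≥0} (h𝔤 : Monotone 𝔤) {s : ℝ}
    {G : Set Plane} (hG : G ⊆ sector i j s) {r : ℝ} (hr : 0 < r) {D : ℕ} (hD : 16 ≤ D)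
    (hDr : 8 / r ≤ D) : gaugePre 𝔤 (ENNReal.ofReal r) G ≤ D * 𝔤 (1 / 2) := by
  have hD' : (16 : ℝ) ≤ D := by exact_mod_cast hD
  have hD0 : (0 : ℝ) < D := by linarith
  rw [div_le_iff₀ hr] at hDr
  have h1 : G ⊆ {e ∈ G | (-2 : ℝ) < e j / e i ∧ e j / e i ≤ -2 + 4} := by
    intro e he
    have := abs_le.1 (abs_slope_le_one (hG he))
    exact ⟨he, by linarith, by linarith⟩
  refine (MeasureTheory.measure_mono h1).trans
    ((gaugePre_slope_le hij h𝔤 hG (by omega : 2 ≤ D) (l₀ := min (1 / 2) r)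
      (le_min (by norm_num) hr.le) ?_ ?_).trans ?_)
  · rw [div_le_iff₀ hD0]
    rcases min_choice (1 / 2) r with h | h <;> rw [h] <;> nlinarith
  · exact ENNReal.ofReal_le_ofReal (min_le_right _ _)
  · gcongr
    apply h𝔤
    rw [Real.toNNReal_le_iff_le_coe]
    simp

theorem gaugePre_sector_ne_top (hij : i ≠ j) {𝔤 : ℝ≥0 → ℝ≥0} (h𝔤 : Monotone 𝔤) {s : ℝ}
    {G : Set Plane} (hG : G ⊆ sector i j s) {r : ℝ} (hr : 0 < r) :
    gaugePre 𝔤 (ENNReal.ofReal r) G ≠ ⊤ := by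
  obtain ⟨D, hD⟩ := exists_nat_ge (max 16 (8 / r))
  have h16 : 16 ≤ D := by exact_mod_cast (le_max_left _ _).trans hD
  refine ((gaugePre_sector_le hij h𝔤 hG hr h16 ((le_max_right _ _).trans hD)).trans_lt ?_).ne
  exact ENNReal.mul_lt_top (ENNReal.natCast_lt_top D) ENNReal.coe_lt_top

theorem slopeDistribution_mono (hij : i ≠ j) {𝔤 : ℝ≥0 → ℝ≥0} (h𝔤 : Monotone 𝔤) {s : ℝ}
    {G : Set Plane} (hG : G ⊆ sector i j s) {r : ℝ} (hr : 0 < r) (T : ℕ) :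
    Monotone (slopeDistribution i j 𝔤 r T G) := by
  intro a b hab
  refine ENNReal.toReal_mono (gaugePre_sector_ne_top hij h𝔤 ((Set.sep_subset _ _).trans hG) hr)
    (MeasureTheory.measure_mono ?_)
  rintro e ⟨he, h⟩
  refine ⟨he, h.trans ?_⟩
  gcongr

/-- Subadditivity of the content is all that is needed to control increments from above. -/
theorem slopeDistribution_sub_le (hij : i ≠ j) {𝔤 : ℝ≥0 → ℝ≥0} (h𝔤 : Monotone 𝔤) {s : ℝ}
    {G : Set Plane} (hG : G ⊆ sector i j s) {r : ℝ} (hr : 0 < r) (T a l : ℕ) :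
    slopeDistribution i j 𝔤 r T G (a + l) - slopeDistribution i j 𝔤 r T G a
      ≤ (gaugePre 𝔤 (ENNReal.ofReal r) {e ∈ G | -2 + (a : ℝ) / (T + 1) < e j / e i ∧
          e j / e i ≤ (-2 + (a : ℝ) / (T + 1)) + (l : ℝ) / (T + 1)}).toReal := by
  have hfin : ∀ P : Plane → Prop, gaugePre 𝔤 (ENNReal.ofReal r) {e ∈ G | P e} ≠ ⊤ :=
    fun P => gaugePre_sector_ne_top hij h𝔤 ((Set.sep_subset _ _).trans hG) hr
  rw [sub_le_iff_le_add', slopeDistribution, slopeDistribution, ← ENNReal.toReal_add (hfin _) (hfin _)]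
  refine ENNReal.toReal_mono (ENNReal.add_ne_top.2 ⟨hfin _, hfin _⟩)
    ((MeasureTheory.measure_mono ?_).trans (MeasureTheory.measure_union_le _ _))
  rintro e ⟨he, h⟩
  rcases le_or_gt (e j / e i) (-2 + (a : ℝ) / (T + 1)) with h' | h'
  · exact Or.inl ⟨he, h'⟩
  · refine Or.inr ⟨he, h', h.trans (le_of_eq ?_)⟩
    push_cast
    ring

theorem slopeDistribution_inc_le (hij : i ≠ j) {𝔤 : ℝ≥0 → ℝ≥0} (h𝔤 : Monotone 𝔤) {s : ℝ}
    {G : Set Plane} (hG : G ⊆ sector i j s) {r : ℝ} (hr : 0 < r) {D : ℕ} (hD : 16 ≤ D)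
    (hDr : 8 / r ≤ D) (T a l : ℕ) (hl : l ≤ T + 1) :
    slopeDistribution i j 𝔤 r T G (a + l) - slopeDistribution i j 𝔤 r T G a
      ≤ D * 𝔤 ((l : ℝ) / (T + 1)).toNNReal := by
  have hD' : (16 : ℝ) ≤ D := by exact_mod_cast hD
  have hD0 : (0 : ℝ) < D := by linarith
  rw [div_le_iff₀ hr] at hDr
  have hx0 : 0 ≤ (l : ℝ) / (T + 1) := by positivity
  have hx1 : (l : ℝ) / (T + 1) ≤ 1 := by
    rw [div_le_one (by positivity)]; exact_mod_cast hl
  refine (slopeDistribution_sub_le hij h𝔤 hG hr T a l).trans ?_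
  set x := (l : ℝ) / (T + 1) with hx
  have key := gaugePre_slope_le hij h𝔤 hG (by omega : 2 ≤ D) (a := -2 + (a : ℝ) / (T + 1)) (l := x)
    (l₀ := min x r) (le_min hx0 hr.le)
    (by
      rw [div_le_iff₀ hD0]
      rcases min_choice x r with h | h <;> rw [h] <;> nlinarith)
    (ENNReal.ofReal_le_ofReal (min_le_right _ _))
  have h2 : (D : ℝ≥0∞) * 𝔤 (min x r).toNNReal ≤ ((D * 𝔤 x.toNNReal : ℝ≥0) : ℝ≥0∞) := by
    push_cast
    gcongr
    exact h𝔤 (Real.toNNReal_le_toNNReal (min_le_left _ _))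
  have h3 := ENNReal.toReal_mono ENNReal.coe_ne_top (key.trans h2)
  simpa using h3

/-- The discrete Kakeya maximal inequality: if, for every direction `e` of `G`, the segment `𝓛 e`
meets at least `m₀` of the squares of `Q`, then `Q` is large. -/
theorem gaugePre_mul_sq_le (hij : i ≠ j) {𝔤 : ℝ≥0 → ℝ≥0} (h𝔤 : IsDimensionFunction 𝔤) {s : ℝ}
    {G : Set Plane} (hG : G ⊆ sector i j s) {r : ℝ} (hr : 0 < r) {D : ℕ} (hD : 16 ≤ D)
    (hDr : 8 / r ≤ D) {T : ℕ} (hT : 1 ≤ T) {N : ℝ} (hN : 0 ≤ N) {𝓛 : Plane → Set Plane}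
    (h𝓛 : ∀ e ∈ G, ∀ z ∈ 𝓛 e, ∀ y ∈ 𝓛 e, ∃ c : ℝ, |c| ≤ N ∧ z - y = c • e)
    (Q : Finset (ℤ × ℤ)) {m₀ : ℝ} (hm₀ : 0 ≤ m₀)
    (hQ : ∀ e ∈ G, ∀ A : Finset (ℤ × ℤ),
      (∀ q ∈ Q, (∃ z ∈ 𝓛 e, cell i j (1 / (T + 1)) z = q) → q ∈ A) → m₀ ≤ A.card) :
    (gaugePre 𝔤 (ENNReal.ofReal r) G).toReal * m₀ ^ 2
      ≤ (40 + 4 * N) * (3 * D * kakeyaConst 𝔤 (1 / (T + 1))) * Q.card := by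
  classical
  set F := slopeDistribution i j 𝔤 r T G with hF
  have hT0 : (0 : ℝ) < T + 1 := by positivity
  have hT1 : (1 : ℝ) ≤ T := by exact_mod_cast hT
  have hmono : Monotone F := slopeDistribution_mono hij h𝔤.monotone hG hr T
  have hw : ∀ m, 0 ≤ F (m + 1) - F m := fun m => sub_nonneg.2 (hmono m.le_succ)
  have hη : (0 : ℝ) < 1 / (T + 1) := by positivity
  have hC : 0 ≤ kakeyaConst 𝔤 (1 / (T + 1)) := by
    refine kakeyaConst_nonneg 𝔤 ?_
    rw [div_le_one hT0]
    linarith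
  have htot : ∀ m, F m ≤ D * 𝔤 (1 / 2) := by
    intro m
    have h1 := (MeasureTheory.measure_mono (μ := gaugePre 𝔤 (ENNReal.ofReal r))
      (Set.sep_subset G fun e => e j / e i ≤ -2 + (m : ℝ) / (T + 1))).trans
        (gaugePre_sector_le hij h𝔤.monotone hG hr hD hDr)
    have h2 := ENNReal.toReal_mono
      (ENNReal.mul_ne_top (ENNReal.natCast_ne_top D) ENNReal.coe_ne_top) h1
    simpa [F, slopeDistribution] using h2
  have hF0 : F 0 = 0 := by
    have : {e ∈ G | e j / e i ≤ -2 + ((0 : ℕ) : ℝ) / (T + 1)} = ∅ := by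
      refine Set.eq_empty_of_forall_notMem ?_
      rintro e ⟨he, h⟩
      have := abs_le.1 (abs_slope_le_one (hG he))
      simp at h
      linarith
    simp only [hF, slopeDistribution, this, MeasureTheory.measure_empty, ENNReal.toReal_zero]
  have hFM : F (4 * (T + 1)) = (gaugePre 𝔤 (ENNReal.ofReal r) G).toReal := by
    have : {e ∈ G | e j / e i ≤ -2 + ((4 * (T + 1) : ℕ) : ℝ) / (T + 1)} = G := by
      refine Set.Subset.antisymm (Set.sep_subset _ _) fun e he => ⟨he, ?_⟩
      have := abs_le.1 (abs_slope_le_one (hG he))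
      push_cast
      rw [mul_div_cancel_right₀ _ hT0.ne']
      linarith
    simp only [hF, slopeDistribution, this]
  -- A slope cell of positive weight is nonempty, so a representative direction can be picked in it;
  -- the remaining cells carry no weight.
  have hex : ∀ m, ∃ e : Plane, 0 < F (m + 1) - F m → e ∈ G ∧
      -2 + (m : ℝ) / (T + 1) < e j / e i ∧ e j / e i ≤ -2 + ((m : ℝ) + 1) / (T + 1) := by
    intro m
    by_cases h : 0 < F (m + 1) - F m
    · have h1 := h.trans_le (slopeDistribution_sub_le hij h𝔤.monotone hG hr T m 1)
      have h2 : {e ∈ G | -2 + (m : ℝ) / (T + 1) < e j / e i ∧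
          e j / e i ≤ (-2 + (m : ℝ) / (T + 1)) + ((1 : ℕ) : ℝ) / (T + 1)}.Nonempty := by
        by_contra hne
        rw [Set.not_nonempty_iff_eq_empty.1 hne] at h1
        simp at h1
      obtain ⟨e, he, h3, h4⟩ := h2
      refine ⟨e, fun _ => ⟨he, h3, h4.trans (le_of_eq ?_)⟩⟩
      push_cast
      ring
    · exact ⟨0, fun h' => absurd h' h⟩
  choose e he using hex
  set M := 4 * (T + 1) with hM
  set S := (Finset.range M).filter fun m => 0 < F (m + 1) - F m with hS
  have hSpos : ∀ m ∈ S, 0 < F (m + 1) - F m := fun m hm => (Finset.mem_filter.1 hm).2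
  have hSM : ∀ m ∈ S, m < M := fun m hm => Finset.mem_range.1 (Finset.mem_filter.1 hm).1
  have hsum : ∑ m ∈ S, (F (m + 1) - F m) = (gaugePre 𝔤 (ENNReal.ofReal r) G).toReal := by
    rw [hS, Finset.sum_filter_of_ne fun m _ h => (hw m).lt_of_ne' h, Finset.sum_range_sub, hF0,
      hFM, sub_zero]
  let A : ℕ → Finset (ℤ × ℤ) := fun m =>
    Q.filter fun q => ∃ z ∈ 𝓛 (e m), cell i j (1 / (T + 1)) z = q
  have hline : ∀ m ∈ S, (∀ z ∈ 𝓛 (e m), ∀ y ∈ 𝓛 (e m), z j - y j = (e m j / e m i) * (z i - y i))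
      ∧ ∀ z ∈ 𝓛 (e m), ∀ y ∈ 𝓛 (e m), |z i - y i| ≤ N := by
    intro m hm
    obtain ⟨heG, -, -⟩ := he m (hSpos m hm)
    have hsec := hG heG
    have hei : e m i ≠ 0 := fun h => by simpa [h] using hsec.2.1
    have hei1 : |e m i| ≤ 1 := by
      have := abs_coord_sub_le_dist i (e m) 0
      simpa [hsec.1] using this
    constructor
    · intro z hz y hy
      obtain ⟨c, -, hc⟩ := h𝓛 _ heG z hz y hy
      have h1 : z j - y j = c * e m j := by simpa using congrArg (fun v : Plane => v j) hc
      have h2 : z i - y i = c * e m i := by simpa using congrArg (fun v : Plane => v i) hc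
      rw [h1, h2]
      field_simp
    · intro z hz y hy
      obtain ⟨c, hcN, hc⟩ := h𝓛 _ heG z hz y hy
      have h2 : z i - y i = c * e m i := by simpa using congrArg (fun v : Plane => v i) hc
      rw [h2, abs_mul]
      exact (mul_le_of_le_one_right (abs_nonneg _) hei1).trans hcN
  have hcard : ∀ m ∈ S, ∀ m' ∈ S, ((A m ∩ A m').card : ℝ)
      ≤ (40 + 4 * N) * ((T + 1) / ((Nat.dist m m' : ℝ) + 1)) := by
    intro m hm m' hm'
    obtain ⟨heG, hp1, hp2⟩ := he m (hSpos m hm)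
    obtain ⟨heG', hp1', hp2'⟩ := he m' (hSpos m' hm')
    set d : ℕ := Nat.dist m m' with hd
    have hd0 : (0 : ℝ) < (d : ℝ) + 1 := by positivity
    -- For `d ≤ 1` the slopes may coincide, and the `2 * N` in `R` covers the whole length. For `d ≥
    -- 2` they differ by at least `(d - 1) / (T + 1)`, and `12 * (d - 1) / (d + 1) ≥ 4`. As `d + 1 ≤
    -- 4 * (T + 1)`, the additive `4` in `2 * (R + 2)` costs `16` more, giving `40 + 4 * N`.
    have hcell := card_cells_le (i := i) (j := j) hη (abs_slope_le_one (hG heG))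
      (abs_slope_le_one (hG heG')) (R := (12 + 2 * N) * ((T + 1) / ((d : ℝ) + 1))) (N := N)
      (by positivity) (hline m hm).1 (hline m hm).2 (hline m' hm').1 (S := A m ∩ A m')
      (fun q hq => (Finset.mem_filter.1 (Finset.mem_inter.1 hq).1).2)
      (fun q hq => (Finset.mem_filter.1 (Finset.mem_inter.1 hq).2).2) ?_
    · have hdM : d + 1 ≤ M := by
        have h1 := hSM m hm
        have h2 := hSM m' hm'
        have h3 : d = m - m' + (m' - m) := rfl
        omega
      have hdM' : (d : ℝ) + 1 ≤ 4 * (T + 1) := by exact_mod_cast hdM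
      have h1 : 1 ≤ 4 * (((T : ℝ) + 1) / (d + 1)) := by
        rw [← mul_div_assoc, le_div_iff₀ hd0]; linarith
      linarith
    · have hR : (12 + 2 * N) * (((T : ℝ) + 1) / ((d : ℝ) + 1)) * (1 / (T + 1))
          = (12 + 2 * N) / (d + 1) := by field_simp
      rw [hR]
      rcases Nat.lt_or_ge d 2 with h | h
      · left
        have : (d : ℝ) + 1 ≤ 2 := by
          have : (d + 1 : ℕ) ≤ 2 := h
          exact_mod_cast this
        rw [le_div_iff₀ hd0]
        nlinarith
      · right
        have h2 : (2 : ℝ) ≤ d := by exact_mod_cast h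
        have hsep : ((d : ℝ) - 1) * (1 / (T + 1)) ≤ |e m j / e m i - e m' j / e m' i| := by
          have hdd : (d : ℝ) = |(m : ℝ) - m'| := by
            have h3 : d = m - m' + (m' - m) := rfl
            rcases le_total m m' with hle | hle
            · rw [abs_sub_comm, abs_of_nonneg (by simpa using hle), h3, Nat.sub_eq_zero_of_le hle,
                zero_add, Nat.cast_sub hle]
            · rw [abs_of_nonneg (by simpa using hle), h3, Nat.sub_eq_zero_of_le hle,
                add_zero, Nat.cast_sub hle]
          have e1 : (m : ℝ) / (T + 1) = m * (1 / (T + 1)) := by ring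
          have e2 : ((m : ℝ) + 1) / (T + 1) = (m + 1) * (1 / (T + 1)) := by ring
          have e3 : (m' : ℝ) / (T + 1) = m' * (1 / (T + 1)) := by ring
          have e4 : ((m' : ℝ) + 1) / (T + 1) = (m' + 1) * (1 / (T + 1)) := by ring
          rw [e1] at hp1
          rw [e2] at hp2
          rw [e3] at hp1'
          rw [e4] at hp2'
          rw [hdd]
          rcases abs_cases ((m : ℝ) - m') with ⟨h', -⟩ | ⟨h', -⟩
          · rw [h']
            refine le_trans ?_ (le_abs_self _)
            linarith
          · rw [h']
            refine le_trans ?_ (neg_le_abs _)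
            linarith
        refine le_trans ?_ (mul_le_mul_of_nonneg_right hsep (by positivity))
        rw [show ((d : ℝ) - 1) * (1 / (T + 1)) * ((12 + 2 * N) / (d + 1))
          = ((d - 1) * (12 + 2 * N) / (d + 1)) * (1 / (T + 1)) by ring]
        refine mul_le_mul_of_nonneg_right ?_ hη.le
        rw [le_div_iff₀ hd0]
        nlinarith
  have := sum_mul_sq_le_of_incidence S (fun m => F (m + 1) - F m) (fun m _ => hw m) Q A
    (fun m _ => Finset.filter_subset _ _) hm₀
    (fun m hm => hQ _ (he m (hSpos m hm)).1 (A m) fun q hq hz => Finset.mem_filter.2 ⟨hq, hz⟩)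
    (H := (40 + 4 * N) * (3 * D * kakeyaConst 𝔤 (1 / (T + 1)))) (by positivity) ?_
  · rwa [hsum] at this
  · intro m hm
    calc ∑ m' ∈ S, (F (m' + 1) - F m') * ((A m ∩ A m').card : ℝ)
        ≤ ∑ m' ∈ S, (F (m' + 1) - F m') *
            ((40 + 4 * N) * ((T + 1) / ((Nat.dist m m' : ℝ) + 1))) :=
          Finset.sum_le_sum fun m' hm' =>
            mul_le_mul_of_nonneg_left (hcard m hm m' hm') (hw m')
      _ ≤ ∑ m' ∈ Finset.range M, (F (m' + 1) - F m') *
            ((40 + 4 * N) * ((T + 1) / ((Nat.dist m m' : ℝ) + 1))) :=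
          Finset.sum_le_sum_of_subset_of_nonneg (Finset.filter_subset _ _)
            fun m' _ _ => mul_nonneg (hw m') (by positivity)
      _ = (40 + 4 * N) * ∑ m' ∈ Finset.range M, (F (m' + 1) - F m') *
            ((T + 1) / ((Nat.dist m m' : ℝ) + 1)) := by
          rw [Finset.mul_sum]
          exact Finset.sum_congr rfl fun _ _ => by ring
      _ ≤ _ := by
          refine mul_le_mul_of_nonneg_left ?_ (by positivity)
          exact sum_increment_div_le h𝔤 hT hmono hF0.ge D.cast_nonneg
            (fun a l hl => slopeDistribution_inc_le hij h𝔤.monotone hG hr hD hDr T a l hl) htot M m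

end Scale

/-! ### From covers to squares, one dyadic level at a time -/

section Cover

variable {i j : Fin 2}

/-- The bound at one scale: if the part of each segment `𝓛 e`, `e ∈ G`, that is covered by finitely
many sets of diameter at most `2 ^ (-k)` has large content, then there are many such sets. -/
theorem gaugePre_mul_sq_le_card (hij : i ≠ j) {𝔤 𝔥 : ℝ≥0 → ℝ≥0} (h𝔤 : IsDimensionFunction 𝔤)
    (h𝔥 : IsDimensionFunction 𝔥) {c : ℝ≥0} (hc : ∀ x, 𝔥 (2 * x) ≤ c * 𝔥 x) {s : ℝ}
    {G : Set Plane} (hG : G ⊆ sector i j s) {r : ℝ} (hr : 0 < r) {D : ℕ} (hD : 16 ≤ D)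
    (hDr : 8 / r ≤ D) {k : ℕ} (hk : 1 ≤ k) {N : ℝ} (hN : 0 ≤ N) {𝓛 : Plane → Set Plane}
    (h𝓛 : ∀ e ∈ G, ∀ z ∈ 𝓛 e, ∀ y ∈ 𝓛 e, ∃ c : ℝ, |c| ≤ N ∧ z - y = c • e)
    {ρ : ℝ} (hρ : 2 * (1 / 2) ^ k ≤ ρ) (J : Finset ℕ) (U : ℕ → Set Plane)
    (hU : ∀ t ∈ J, Metric.ediam (U t) ≤ ENNReal.ofReal ((1 / 2) ^ k)) {a : ℝ} (ha : 0 ≤ a)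
    (hGa : ∀ e ∈ G, ENNReal.ofReal a ≤ gaugePre 𝔥 (ENNReal.ofReal ρ) (𝓛 e ∩ ⋃ t ∈ J, U t)) :
    (gaugePre 𝔤 (ENNReal.ofReal r) G).toReal * a ^ 2
      ≤ (40 + 4 * N) * (3 * D) * (c : ℝ) ^ 4 * 9 *
        (((𝔥 ((1 / 2) ^ (k + 1)) : ℝ) ^ 2 * kakeyaConst 𝔤 ((1 / 2) ^ k)) * J.card) := by
  classical
  have hη : (0 : ℝ) < (1 / 2) ^ k := by positivity
  obtain ⟨T, hT⟩ : ∃ T : ℕ, T + 1 = 2 ^ k := ⟨2 ^ k - 1, Nat.sub_add_cancel Nat.one_le_two_pow⟩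
  have hT1 : 1 ≤ T := by
    have : 2 ^ 1 ≤ 2 ^ k := Nat.pow_le_pow_right (by norm_num) hk
    omega
  have hTη : (1 : ℝ) / ((T : ℝ) + 1) = (1 / 2) ^ k := by
    have : (T : ℝ) + 1 = 2 ^ k := by exact_mod_cast hT
    rw [this, one_div_pow]
  have hC : 0 ≤ kakeyaConst 𝔤 ((1 / 2) ^ k) :=
    kakeyaConst_nonneg 𝔤 (pow_le_one₀ (by norm_num) (by norm_num))
  choose! z hz using fun (t : ℕ) (h : (U t).Nonempty) => h
  set Q := J.biUnion fun t => cellBlock i j ((1 / 2) ^ k) (z t) with hQ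
  have hQcard : (Q.card : ℝ) ≤ 9 * J.card := by
    have : Q.card ≤ J.card * 9 := Finset.card_biUnion_le_card_mul _ _ _ fun t _ =>
      (card_cellBlock _ _).le
    have h' : (Q.card : ℝ) ≤ J.card * 9 := by exact_mod_cast this
    linarith
  -- A square has diameter at most `2 * 2^{-k} = 4 * 2^{-k-1}`. Doubling twice reaches the argument
  -- used in the series, and squaring later produces `c ^ 4`.
  set b : ℝ≥0 := c * (c * 𝔥 ((1 / 2) ^ (k + 1))) with hb
  have hb2 : 𝔥 (2 * (1 / 2) ^ k) ≤ b := by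
    refine (hc _).trans (mul_le_mul_right ?_ c)
    refine le_trans (le_of_eq ?_) (hc ((1 / 2) ^ (k + 1)))
    congr 1
    rw [pow_succ]
    ring_nf
  have hcount : ∀ e ∈ G, ∀ A : Finset (ℤ × ℤ),
      (∀ q ∈ Q, (∃ x ∈ 𝓛 e, cell i j ((1 / 2) ^ k) x = q) → q ∈ A) → a ≤ A.card * b := by
    intro e he A hA
    have hsub : 𝓛 e ∩ ⋃ t ∈ J, U t ⊆ ⋃ q ∈ A, {x | cell i j ((1 / 2) ^ k) x = q} := by
      rintro x ⟨hx, hxU⟩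
      simp only [Set.mem_iUnion] at hxU ⊢
      obtain ⟨t, ht, hxt⟩ := hxU
      refine ⟨cell i j ((1 / 2) ^ k) x, hA _ ?_ ⟨x, hx, rfl⟩, rfl⟩
      refine Finset.mem_biUnion.2 ⟨t, ht, cell_mem_cellBlock hη ?_⟩
      have h1 := (Metric.edist_le_ediam_of_mem hxt (hz t ⟨x, hxt⟩)).trans (hU t ht)
      rwa [edist_dist, ENNReal.ofReal_le_ofReal_iff hη.le] at h1
    have h2 : gaugePre 𝔥 (ENNReal.ofReal ρ) (𝓛 e ∩ ⋃ t ∈ J, U t) ≤ A.card * b := by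
      refine (MeasureTheory.measure_mono hsub).trans
        ((MeasureTheory.measure_biUnion_finset_le _ _).trans ?_)
      rw [← nsmul_eq_mul, ← Finset.sum_const]
      refine Finset.sum_le_sum fun q _ => ?_
      refine (gaugePre_le_of_dist h𝔥.monotone (c := 2 * (1 / 2) ^ k) ?_ ?_).trans
        (ENNReal.coe_le_coe.2 hb2)
      · rw [← ENNReal.ofReal_coe_nnreal]
        refine ENNReal.ofReal_le_ofReal ?_
        simpa using hρ
      · rintro x rfl y hy
        have := dist_le_of_cell_eq hij hη hy
        rw [dist_comm]
        simpa using this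
    have h3 := (hGa e he).trans h2
    rw [ENNReal.ofReal_le_iff_le_toReal
      (ENNReal.mul_ne_top (ENNReal.natCast_ne_top _) ENNReal.coe_ne_top)] at h3
    simpa using h3
  -- The count `a / b` of squares met is meaningless for `b = 0`; but then `a = 0` or `G` is empty.
  rcases eq_or_ne b 0 with hb0 | hb0
  · have : (gaugePre 𝔤 (ENNReal.ofReal r) G).toReal * a ^ 2 = 0 := by
      rcases G.eq_empty_or_nonempty with h0 | ⟨e, he⟩
      · simp [h0]
      · have := hcount e he Q fun q hq _ => hq
        rw [hb0, NNReal.coe_zero, mul_zero] at this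
        simp [le_antisymm this ha]
    rw [this]
    positivity
  · have hbpos : (0 : ℝ) < b := NNReal.coe_pos.2 (pos_iff_ne_zero.2 hb0)
    have := gaugePre_mul_sq_le hij h𝔤 hG hr hD hDr hT1 hN h𝓛 Q (m₀ := a / b) (by positivity)
      (fun e he A hA => by
        rw [hTη] at hA
        rw [div_le_iff₀ hbpos]
        exact hcount e he A hA)
    rw [hTη, div_pow, ← mul_div_assoc, div_le_iff₀ (by positivity)] at this
    refine this.trans ?_
    have hb' : (b : ℝ) ^ 2 = (c : ℝ) ^ 4 * (𝔥 ((1 / 2) ^ (k + 1)) : ℝ) ^ 2 := by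
      rw [hb]; push_cast; ring
    rw [hb']
    calc (40 + 4 * N) * (3 * D * kakeyaConst 𝔤 ((1 / 2) ^ k)) * Q.card *
          ((c : ℝ) ^ 4 * (𝔥 ((1 / 2) ^ (k + 1)) : ℝ) ^ 2)
        ≤ (40 + 4 * N) * (3 * D * kakeyaConst 𝔤 ((1 / 2) ^ k)) * (9 * J.card) *
          ((c : ℝ) ^ 4 * (𝔥 ((1 / 2) ^ (k + 1)) : ℝ) ^ 2) := by gcongr
      _ = _ := by ring

/-- The indices of the covering sets of diameter in `(2 ^ (-k - 1), 2 ^ (-k)]`. -/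
def dyadicLevel (U : ℕ → Set Plane) (k : ℕ) : Set ℕ :=
  {t | ENNReal.ofReal ((1 / 2) ^ (k + 1)) < Metric.ediam (U t) ∧
    Metric.ediam (U t) ≤ ENNReal.ofReal ((1 / 2) ^ k)}

theorem dyadicLevel_unique {U : ℕ → Set Plane} {k l t : ℕ} (hk : t ∈ dyadicLevel U k)
    (hl : t ∈ dyadicLevel U l) : k = l := by
  have key : ∀ {k l : ℕ}, t ∈ dyadicLevel U k → t ∈ dyadicLevel U l → ¬ k < l := by
    intro k l hk hl h
    refine (hk.1.trans_le hl.2).not_ge (ENNReal.ofReal_le_ofReal ?_)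
    exact pow_le_pow_of_le_one (by norm_num) (by norm_num) h
  exact le_antisymm (not_lt.1 (key hl hk)) (not_lt.1 (key hk hl))

theorem exists_mem_dyadicLevel {U : ℕ → Set Plane} {k₀ t : ℕ}
    (h0 : Metric.ediam (U t) ≠ 0) (h : Metric.ediam (U t) ≤ ENNReal.ofReal ((1 / 2) ^ k₀)) :
    ∃ m, t ∈ dyadicLevel U (k₀ + m) := by
  have hfin : Metric.ediam (U t) ≠ ⊤ := ne_top_of_le_ne_top ENNReal.ofReal_ne_top h
  have hd : ENNReal.ofReal (Metric.ediam (U t)).toReal = Metric.ediam (U t) :=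
    ENNReal.ofReal_toReal hfin
  have hpos : 0 < (Metric.ediam (U t)).toReal := ENNReal.toReal_pos h0 hfin
  have hle : (Metric.ediam (U t)).toReal ≤ (1 / 2) ^ k₀ := by
    rwa [← hd, ENNReal.ofReal_le_ofReal_iff (by positivity)] at h
  obtain ⟨n, hn1, hn2⟩ := exists_nat_pow_near_of_lt_one hpos
    (hle.trans (pow_le_one₀ (by norm_num) (by norm_num)) : _ ≤ (1 : ℝ))
    (by norm_num : (0 : ℝ) < 1 / 2) (by norm_num)
  have hk : k₀ ≤ n := by
    by_contra hlt
    have : ((1 : ℝ) / 2) ^ k₀ ≤ (1 / 2) ^ (n + 1) :=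
      pow_le_pow_of_le_one (by norm_num) (by norm_num) (by omega)
    linarith
  refine ⟨n - k₀, ?_⟩
  rw [Nat.add_sub_cancel' hk]
  refine ⟨?_, ?_⟩
  · rw [← hd]; exact (ENNReal.ofReal_lt_ofReal_iff hpos).2 hn1
  · rw [← hd]; exact ENNReal.ofReal_le_ofReal hn2

theorem tsum_tsum_indicator_dyadicLevel_le (U : ℕ → Set Plane) (k₀ : ℕ) (f : ℕ → ℝ≥0∞) :
    ∑' m, ∑' t, (dyadicLevel U (k₀ + m)).indicator f t ≤ ∑' t, f t := by
  rw [ENNReal.tsum_comm]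
  refine ENNReal.tsum_le_tsum fun t => ?_
  by_cases h : ∃ m, t ∈ dyadicLevel U (k₀ + m)
  · obtain ⟨m, hm⟩ := h
    rw [tsum_eq_single m]
    · rw [Set.indicator_of_mem hm]
    · intro m' hne
      refine Set.indicator_of_notMem (fun hm' => hne ?_) f
      have := dyadicLevel_unique hm hm'
      omega
  · push Not at h
    simp [Set.indicator_of_notMem (h _)]

/-- The bound at one scale for an arbitrary cover. -/
theorem gaugePre_le_tsum_dyadicLevel (hij : i ≠ j) {𝔤 𝔥 h : ℝ≥0 → ℝ≥0}
    (h𝔤 : IsDimensionFunction 𝔤)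
    (h𝔥 : IsDimensionFunction 𝔥) (hh : IsDimensionFunction h) {c : ℝ≥0} (hc0 : 0 < c)
    (hc : ∀ x, 𝔥 (2 * x) ≤ c * 𝔥 x) {s : ℝ}
    {G : Set Plane} (hG : G ⊆ sector i j s) {r : ℝ} (hr : 0 < r) {D : ℕ} (hD : 16 ≤ D)
    (hDr : 8 / r ≤ D) {k : ℕ} (hk : 1 ≤ k) {N : ℝ} (hN : 0 ≤ N) {𝓛 : Plane → Set Plane}
    (h𝓛 : ∀ e ∈ G, ∀ z ∈ 𝓛 e, ∀ y ∈ 𝓛 e, ∃ c : ℝ, |c| ≤ N ∧ z - y = c • e)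
    {ρ : ℝ} (hρ : 2 * (1 / 2) ^ k ≤ ρ) (U : ℕ → Set Plane)
    (hhk : 0 < h ((1 / 2) ^ (k + 1))) {β a : ℝ} (hβ : 0 < β) (ha : 0 < a)
    (hβa : β * √((𝔥 ((1 / 2) ^ (k + 1)) : ℝ) ^ 2 * kakeyaConst 𝔤 ((1 / 2) ^ k)
        / (h ((1 / 2) ^ (k + 1)) : ℝ)) ≤ a)
    (hGa : ∀ e ∈ G, ENNReal.ofReal a ≤
      gaugePre 𝔥 (ENNReal.ofReal ρ) (𝓛 e ∩ ⋃ t ∈ dyadicLevel U k, U t)) :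
    gaugePre 𝔤 (ENNReal.ofReal r) G ≤
      ENNReal.ofReal ((40 + 4 * N) * (3 * D) * (c : ℝ) ^ 4 * 9 / β ^ 2) *
        ∑' t, (dyadicLevel U k).indicator
          (fun t => (h (Metric.ediam (U t)).toNNReal : ℝ≥0∞)) t := by
  set K : ℝ := (40 + 4 * N) * (3 * D) * (c : ℝ) ^ 4 * 9 with hK
  have hDpos : (0 : ℝ) < D := by
    have : (16 : ℝ) ≤ D := by exact_mod_cast hD
    linarith
  have hc0' : (0 : ℝ) < c := NNReal.coe_pos.2 hc0
  have hKpos : 0 < K := by positivity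
  have hC : 0 ≤ kakeyaConst 𝔤 ((1 / 2) ^ k) :=
    kakeyaConst_nonneg 𝔤 (pow_le_one₀ (by norm_num) (by norm_num))
  have hterm : ∀ t ∈ dyadicLevel U k,
      (h ((1 / 2) ^ (k + 1)) : ℝ≥0∞) ≤ h (Metric.ediam (U t)).toNNReal := by
    intro t ht
    refine ENNReal.coe_le_coe.2 (hh.monotone ?_)
    have hfin : Metric.ediam (U t) ≠ ⊤ := ne_top_of_le_ne_top ENNReal.ofReal_ne_top ht.2
    rw [← ENNReal.coe_le_coe, ENNReal.coe_toNNReal hfin, ← ENNReal.ofReal_coe_nnreal]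
    refine le_trans (le_of_eq ?_) ht.1.le
    simp
  -- An infinite level makes the right side infinite, since each of its sets contributes at least `h
  -- (2^{-k-1}) > 0`.
  rcases Set.finite_or_infinite (dyadicLevel U k) with hfin | hinf
  · set J := hfin.toFinset with hJ
    have hJmem : ∀ t, t ∈ J ↔ t ∈ dyadicLevel U k := fun t => hfin.mem_toFinset
    have hUeq : (⋃ t ∈ dyadicLevel U k, U t) = ⋃ t ∈ J, U t := by simp only [hJmem]
    have h1 := gaugePre_mul_sq_le_card hij h𝔤 h𝔥 hc hG hr hD hDr hk hN h𝓛 hρ J U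
      (fun t ht => ((hJmem t).1 ht).2) ha.le (by rwa [hUeq] at hGa)
    set W := (gaugePre 𝔤 (ENNReal.ofReal r) G).toReal with hW
    have hW0 : 0 ≤ W := ENNReal.toReal_nonneg
    have h2 : W ≤ K / β ^ 2 * (J.card * h ((1 / 2) ^ (k + 1))) := by
      set X : ℝ := (𝔥 ((1 / 2) ^ (k + 1)) : ℝ) ^ 2 * kakeyaConst 𝔤 ((1 / 2) ^ k) with hX
      have hX0 : 0 ≤ X := by positivity
      have hhk' : (0 : ℝ) < h ((1 / 2) ^ (k + 1)) := NNReal.coe_pos.2 hhk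
      rcases hX0.eq_or_lt with h0 | hXpos
      · rw [← h0, zero_mul, mul_zero] at h1
        have : W ≤ 0 := by
          by_contra hcon
          push Not at hcon
          have : 0 < W * a ^ 2 := by positivity
          linarith
        refine this.trans ?_
        positivity
      · have h3 : β ^ 2 * (X / h ((1 / 2) ^ (k + 1))) ≤ a ^ 2 := by
          rw [← Real.sq_sqrt (div_nonneg hX0 hhk'.le), ← mul_pow]
          gcongr
        have h4 := (mul_le_mul_of_nonneg_left h3 hW0).trans h1
        rw [div_mul_eq_mul_div, le_div_iff₀ (by positivity)]
        have h5 : W * (β ^ 2 * (X / h ((1 / 2) ^ (k + 1))))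
            = (W * β ^ 2 / h ((1 / 2) ^ (k + 1))) * X := by ring
        rw [h5, show K * (X * J.card) = (K * J.card) * X by ring] at h4
        have h6 := le_of_mul_le_mul_right h4 hXpos
        rw [div_le_iff₀ hhk'] at h6
        linarith
    rw [← ENNReal.ofReal_toReal (gaugePre_sector_ne_top hij h𝔤.monotone hG hr)]
    refine (ENNReal.ofReal_le_ofReal h2).trans ?_
    rw [ENNReal.ofReal_mul (by positivity)]
    gcongr
    rw [ENNReal.ofReal_mul (by positivity), ENNReal.ofReal_natCast, ENNReal.ofReal_coe_nnreal,
      ← nsmul_eq_mul, ← Finset.sum_const]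
    refine le_trans (Finset.sum_le_sum fun t ht => ?_) (ENNReal.sum_le_tsum J)
    rw [Set.indicator_of_mem ((hJmem t).1 ht)]
    exact hterm t ((hJmem t).1 ht)
  · have htop : ∑' t, (dyadicLevel U k).indicator
        (fun t => (h (Metric.ediam (U t)).toNNReal : ℝ≥0∞)) t = ⊤ := by
      rw [← tsum_subtype]
      have : Infinite (dyadicLevel U k) := hinf.to_subtype
      rw [← top_le_iff, ← ENNReal.tsum_const_eq_top_of_ne_zero (α := dyadicLevel U k)
        (ENNReal.coe_ne_zero.2 hhk.ne')]
      exact ENNReal.tsum_le_tsum fun t => hterm t t.2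
    rw [htop, ENNReal.mul_top]
    · exact le_top
    · rw [Ne, ENNReal.ofReal_eq_zero, not_le]
      positivity

end Cover

/-! ### Pigeonholing over levels and reduction to one sector -/

theorem segment_sub_eq {x e z y : Plane} {t N : ℝ} (ht : 0 < t) (htN : t ≤ N)
    (hz : z ∈ segment ℝ x (x + t • e)) (hy : y ∈ segment ℝ x (x + t • e)) :
    ∃ c : ℝ, |c| ≤ N ∧ z - y = c • e := by
  rw [segment_eq_image'] at hz hy
  obtain ⟨u, ⟨hu0, hu1⟩, rfl⟩ := hz
  obtain ⟨v, ⟨hv0, hv1⟩, rfl⟩ := hy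
  refine ⟨(u - v) * t, ?_, ?_⟩
  · rw [abs_mul, abs_of_pos ht]
    refine le_trans (mul_le_of_le_one_left ht.le ?_) htN
    rw [abs_le]; constructor <;> linarith
  · simp only [add_sub_cancel_left, smul_smul, add_sub_add_left_eq_sub, sub_mul, sub_smul]

/-- Sets of diameter zero belong to no level, but they are countably many and null because `𝔥 0 =
0`. -/
theorem gaugePre_le_tsum_of_cover {𝔥 : ℝ≥0 → ℝ≥0} (h𝔥 : IsDimensionFunction 𝔥) (r : ℝ≥0∞)
    {U : ℕ → Set Plane} {k₀ : ℕ}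
    (hU : ∀ t, Metric.ediam (U t) ≤ ENNReal.ofReal ((1 / 2) ^ k₀)) {l E : Set Plane}
    (hE : E ⊆ ⋃ t, U t) :
    gaugePre 𝔥 r (l ∩ E) ≤ ∑' m, gaugePre 𝔥 r (l ∩ ⋃ t ∈ dyadicLevel U (k₀ + m), U t) := by
  have hsub : l ∩ E ⊆ (⋃ m, l ∩ ⋃ t ∈ dyadicLevel U (k₀ + m), U t) ∪
      ⋃ t ∈ {t | Metric.ediam (U t) = 0}, U t := by
    rintro x ⟨hxl, hxE⟩
    obtain ⟨t, ht⟩ := Set.mem_iUnion.1 (hE hxE)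
    by_cases h0 : Metric.ediam (U t) = 0
    · exact Or.inr (Set.mem_biUnion (s := {t | Metric.ediam (U t) = 0}) h0 ht)
    · obtain ⟨m, hm⟩ := exists_mem_dyadicLevel h0 (hU t)
      exact Or.inl (Set.mem_iUnion.2 ⟨m, hxl, Set.mem_biUnion hm ht⟩)
  have hz : gaugePre 𝔥 r (⋃ t ∈ {t | Metric.ediam (U t) = 0}, U t) = 0 := by
    refine (MeasureTheory.measure_biUnion_null_iff (Set.to_countable _)).2 fun t ht => ?_
    have h0 : Metric.ediam (U t) = 0 := ht
    have := gaugePre_le 𝔥 (s := U t) (r := r) (by rw [h0]; exact zero_le)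
    rw [h0] at this
    simpa [h𝔥.map_zero] using this
  calc gaugePre 𝔥 r (l ∩ E) ≤ _ := MeasureTheory.measure_mono hsub
    _ ≤ _ := MeasureTheory.measure_union_le _ _
    _ ≤ _ := by rw [hz, add_zero]; exact MeasureTheory.measure_iUnion_le _

theorem tendsto_half_pow_succ :
    Tendsto (fun k : ℕ => ((1 / 2) ^ (k + 1) : ℝ≥0)) atTop (𝓝[>] (0 : ℝ≥0)) := by
  refine tendsto_nhdsWithin_iff.2 ⟨?_, Eventually.of_forall fun k => ?_⟩
  · have h : (1 / 2 : ℝ≥0) < 1 := by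
      rw [← NNReal.coe_lt_coe]
      norm_num
    exact (NNReal.tendsto_pow_atTop_nhds_zero_of_lt_one h).comp (tendsto_add_atTop_nat 1)
  · exact Set.mem_Ioi.2 (pow_pos (by positivity) _)

/-- The theorem for a uniform family of directions in one sector. -/
theorem genHausdorff_pos_of_sector {i j : Fin 2} (hij : i ≠ j) {𝔤 𝔥 h : ℝ≥0 → ℝ≥0}
    (h𝔤 : IsDimensionFunction 𝔤) (h𝔥 : IsDimensionFunction 𝔥) (h𝔥d : IsDoubling 𝔥)
    (hh : IsDimensionFunction h) (hpos : ∀ᶠ x in 𝓝[>] (0 : ℝ≥0), 0 < h x)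
    (hsum : Summable fun k : ℕ =>
      √((𝔥 ((1 / 2) ^ (k + 1)) : ℝ) ^ 2 * kakeyaConst 𝔤 ((1 / 2) ^ k)
        / (h ((1 / 2) ^ (k + 1)) : ℝ)))
    {s : ℝ} {G E : Set Plane} (hG : G ⊆ sector i j s) {r : ℝ} (hr : 0 < r)
    (hGpos : 0 < gaugePre 𝔤 (ENNReal.ofReal r) G) {N ρ : ℝ} (hN : 0 ≤ N) (hρ : 0 < ρ)
    (hGE : ∀ e ∈ G, ∃ (x : Plane) (t : ℝ), 0 < t ∧ t ≤ N ∧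
      ENNReal.ofReal ρ ≤ gaugePre 𝔥 (ENNReal.ofReal ρ) (segment ℝ x (x + t • e) ∩ E)) :
    0 < genHausdorff h E := by
  obtain ⟨c, hc0, hc⟩ := h𝔥d
  choose! x t ht htN hGE using hGE
  set 𝓛 : Plane → Set Plane := fun e => segment ℝ (x e) (x e + t e • e) with h𝓛def
  have h𝓛 : ∀ e ∈ G, ∀ z ∈ 𝓛 e, ∀ y ∈ 𝓛 e, ∃ c : ℝ, |c| ≤ N ∧ z - y = c • e :=
    fun e he z hz y hy => segment_sub_eq (ht e he) (htN e he) hz hy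
  obtain ⟨D, hD⟩ := exists_nat_ge (max 16 (8 / r))
  have hD16 : 16 ≤ D := by exact_mod_cast (le_max_left _ _).trans hD
  have hDr : 8 / r ≤ D := (le_max_right _ _).trans hD
  -- The summable extra term `(1 / 2) ^ k` keeps every threshold positive even where the term of the
  -- series vanishes.
  set b : ℕ → ℝ := fun k => √((𝔥 ((1 / 2) ^ (k + 1)) : ℝ) ^ 2 * kakeyaConst 𝔤 ((1 / 2) ^ k)
        / (h ((1 / 2) ^ (k + 1)) : ℝ)) + (1 / 2) ^ k with hb
  have hbsum : Summable b := hsum.add summable_geometric_two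
  have hbpos : ∀ k, 0 < b k := fun k => by positivity
  set B := ∑' k, b k with hB
  have hBpos : 0 < B := hbsum.tsum_pos (fun k => (hbpos k).le) 0 (hbpos 0)
  -- The thresholds then add up to at most `ρ / 2`, so a direction below all of them would
  -- contradict content `ρ`.
  set β := ρ / (2 * B) with hβ
  have hβpos : 0 < β := by positivity
  obtain ⟨k₀, hk₀⟩ : ∃ k₀, ∀ k ≥ k₀,
      0 < h ((1 / 2) ^ (k + 1)) ∧ 1 ≤ k ∧ 2 * (1 / 2 : ℝ) ^ k ≤ ρ := by
    refine eventually_atTop.1 ((tendsto_half_pow_succ.eventually hpos).and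
      ((eventually_ge_atTop 1).and ?_))
    have : Tendsto (fun k : ℕ => 2 * (1 / 2 : ℝ) ^ k) atTop (𝓝 (2 * 0)) :=
      (tendsto_pow_atTop_nhds_zero_of_lt_one (by norm_num) (by norm_num)).const_mul 2
    rw [mul_zero] at this
    exact (this.eventually (gt_mem_nhds hρ)).mono fun k hk => le_of_lt hk
  set K : ℝ≥0∞ := ENNReal.ofReal ((40 + 4 * N) * (3 * D) * (c : ℝ) ^ 4 * 9 / β ^ 2) with hK
  have main : ∀ U : ℕ → Set Plane, E ⊆ ⋃ n, U n →
      (∀ n, Metric.ediam (U n) ≤ ENNReal.ofReal ((1 / 2) ^ k₀)) →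
      gaugePre 𝔤 (ENNReal.ofReal r) G
        ≤ K * ∑' n, (h (Metric.ediam (U n)).toNNReal : ℝ≥0∞) := by
    intro U hEU hU
    set L : ℕ → Set Plane := fun m => {e ∈ G | ENNReal.ofReal (β * b (k₀ + m)) ≤
      gaugePre 𝔥 (ENNReal.ofReal ρ) (𝓛 e ∩ ⋃ n ∈ dyadicLevel U (k₀ + m), U n)} with hL
    have hcover : G ⊆ ⋃ m, L m := by
      intro e he
      by_contra hcon
      have hlt : ∀ m, gaugePre 𝔥 (ENNReal.ofReal ρ) (𝓛 e ∩ ⋃ n ∈ dyadicLevel U (k₀ + m), U n)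
          ≤ ENNReal.ofReal (β * b (k₀ + m)) := by
        intro m
        by_contra hm
        exact hcon (Set.mem_iUnion.2 ⟨m, he, (not_le.1 hm).le⟩)
      have h1 := (hGE e he).trans ((gaugePre_le_tsum_of_cover h𝔥 _ hU hEU).trans
        (ENNReal.tsum_le_tsum hlt))
      have hshift : Summable fun m => b (k₀ + m) := by
        simpa only [add_comm] using (summable_nat_add_iff k₀).2 hbsum
      rw [← ENNReal.ofReal_tsum_of_nonneg (fun m => (mul_pos hβpos (hbpos _)).le)
        (hshift.mul_left β), tsum_mul_left] at h1
      have h2 : ∑' m, b (k₀ + m) ≤ B :=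
        hshift.tsum_le_tsum_of_inj (fun m => k₀ + m) (add_right_injective k₀)
          (fun k _ => (hbpos k).le) (fun m => le_rfl) hbsum
      have h3 : β * ∑' m, b (k₀ + m) ≤ ρ / 2 := by
        refine (mul_le_mul_of_nonneg_left h2 hβpos.le).trans (le_of_eq ?_)
        rw [hβ]
        field_simp
      rw [ENNReal.ofReal_le_ofReal_iff (by
        exact mul_nonneg hβpos.le (tsum_nonneg fun m => (hbpos _).le))] at h1
      linarith
    calc gaugePre 𝔤 (ENNReal.ofReal r) G ≤ gaugePre 𝔤 (ENNReal.ofReal r) (⋃ m, L m) :=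
          MeasureTheory.measure_mono hcover
      _ ≤ ∑' m, gaugePre 𝔤 (ENNReal.ofReal r) (L m) := MeasureTheory.measure_iUnion_le _
      _ ≤ ∑' m, K * ∑' n, (dyadicLevel U (k₀ + m)).indicator
            (fun n => (h (Metric.ediam (U n)).toNNReal : ℝ≥0∞)) n := by
          refine ENNReal.tsum_le_tsum fun m => ?_
          obtain ⟨hk1, hk2, hk3⟩ := hk₀ (k₀ + m) (Nat.le_add_right _ _)
          have hLG : L m ⊆ G := Set.sep_subset _ _
          refine gaugePre_le_tsum_dyadicLevel hij h𝔤 h𝔥 hh hc0 hc (hLG.trans hG) hr hD16 hDr hk2 hN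
            (fun e he => h𝓛 e (hLG he)) hk3 U hk1 hβpos (mul_pos hβpos (hbpos (k₀ + m))) ?_
            (fun e he => he.2)
          refine mul_le_mul_of_nonneg_left ?_ hβpos.le
          exact le_add_of_nonneg_right (by positivity)
      _ ≤ _ := by
          rw [ENNReal.tsum_mul_left]
          exact mul_le_mul_right (tsum_tsum_indicator_dyadicLevel_le U k₀ _) K
  have hlow : gaugePre 𝔤 (ENNReal.ofReal r) G / K ≤ genHausdorff h E := by
    rw [genHausdorff, MeasureTheory.Measure.mkMetric_apply]
    refine le_iSup₂_of_le (ENNReal.ofReal ((1 / 2) ^ k₀)) (ENNReal.ofReal_pos.2 (by positivity)) ?_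
    refine le_iInf fun U => le_iInf fun hEU => le_iInf fun hU => ?_
    refine ENNReal.div_le_of_le_mul' ((main U hEU hU).trans ?_)
    gcongr with n
    rcases (U n).eq_empty_or_nonempty with h0 | h0
    · simp [h0, hh.map_zero]
    · exact le_iSup_of_le h0 le_rfl
  exact (ENNReal.div_pos hGpos.ne' ENNReal.ofReal_ne_top).trans_le hlow

/-- Contents grow as the scale shrinks, so one large integer can serve at once as length bound,
content threshold and scale. The segments thus fall into countably many uniform classes. -/
theorem exists_uniform_gaugePre_le {𝔥 : ℝ≥0 → ℝ≥0} {A : Set Plane} {t : ℝ}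
    (hA : 0 < genHausdorff 𝔥 A) :
    ∃ n : ℕ, t ≤ n + 1 ∧ ENNReal.ofReal (1 / (n + 1)) ≤
      gaugePre 𝔥 (ENNReal.ofReal (1 / (n + 1))) A := by
  obtain ⟨n₁, hn₁⟩ := exists_gaugePre_pos hA
  obtain ⟨n₂, hn₂⟩ := exists_nat_ge t
  obtain ⟨n₃, hn₃⟩ := ENNReal.exists_inv_nat_lt hn₁.ne'
  have key : ∀ m n : ℕ, m ≤ n → ENNReal.ofReal (1 / ((n : ℝ) + 1)) ≤ (m : ℝ≥0∞)⁻¹ := by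
    intro m n hmn
    have : ENNReal.ofReal (1 / ((n : ℝ) + 1)) = ((n + 1 : ℕ) : ℝ≥0∞)⁻¹ := by
      rw [one_div, ENNReal.ofReal_inv_of_pos (by positivity), ← Nat.cast_succ,
        ENNReal.ofReal_natCast]
    rw [this]
    exact ENNReal.inv_le_inv.2 (by exact_mod_cast hmn.trans n.le_succ)
  set n := n₁ + n₂ + n₃ with hn
  refine ⟨n, ?_, ?_⟩
  · have : (n₂ : ℝ) ≤ n := by exact_mod_cast (by omega : n₂ ≤ n)
    linarith
  · exact (key n₃ n (by omega)).trans
      (hn₃.le.trans (gaugePre_antitone 𝔥 (key n₁ n (by omega)) A))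

/-- The series below is `∑_{k ≥ 1} √(𝔥(2^{-k})² C(2^{-k+1}) / h(2^{-k}))`, with `k` shifted by one. -/
theorem mainTheorem6 (𝔤 𝔥 h : ℝ≥0 → ℝ≥0)
    (h𝔤 : IsDimensionFunction 𝔤)
    (h𝔥 : IsDimensionFunction 𝔥) (h𝔥d : IsDoubling 𝔥)
    (hh : IsDimensionFunction h)
    (E : Set Plane) (hE : IsFurstenberg 𝔥 𝔤 E)
    (hprec : DimSmaller h (fun x => 𝔥 x ^ 2 * 𝔤 x / x))
    (hsum : Summable fun k : ℕ =>
      √((𝔥 ((1 / 2) ^ (k + 1)) : ℝ) ^ 2 * kakeyaConst 𝔤 ((1 / 2) ^ k)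
        / (h ((1 / 2) ^ (k + 1)) : ℝ))) :
    0 < genHausdorff h E := by
  obtain ⟨L, hL, hLpos, hLE⟩ := hE
  let G : ℕ × Fin 2 × Fin 2 × ℤ → Set Plane := fun a =>
    {e | a.2.1 ≠ a.2.2.1 ∧ e ∈ sector a.2.1 a.2.2.1 a.2.2.2 ∧
      ∃ (x : Plane) (t : ℝ), 0 < t ∧ t ≤ a.1 + 1 ∧ ENNReal.ofReal (1 / (a.1 + 1)) ≤
        gaugePre 𝔥 (ENNReal.ofReal (1 / (a.1 + 1))) (segment ℝ x (x + t • e) ∩ E)}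
  have hcover : L ⊆ ⋃ a, G a := by
    intro e he
    obtain ⟨i, j, hij, s, hs⟩ := mem_sector_of_norm_eq_one (mem_sphere_zero_iff_norm.1 (hL he))
    obtain ⟨x, t, ht, hxt⟩ := hLE e he
    obtain ⟨n, hn1, hn2⟩ := exists_uniform_gaugePre_le (t := t) hxt
    exact Set.mem_iUnion.2 ⟨(n, i, j, s), hij, hs, x, t, ht, hn1, hn2⟩
  obtain ⟨⟨n, i, j, s⟩, ha⟩ : ∃ a, 0 < genHausdorff 𝔤 (G a) := by
    by_contra hcon
    push Not at hcon
    refine (hLpos.trans_le (MeasureTheory.measure_mono hcover)).ne' ?_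
    exact MeasureTheory.measure_iUnion_null fun a => le_antisymm (hcon a) zero_le
  obtain ⟨m, hm⟩ := exists_gaugePre_pos ha
  -- The condition that the two coordinate indices differ is stored in the membership of `G`; any
  -- element yields it.
  have hne : (G (n, i, j, s)).Nonempty := by
    by_contra h0
    rw [Set.not_nonempty_iff_eq_empty.1 h0] at hm
    simp at hm
  refine genHausdorff_pos_of_sector (i := i) (j := j) (s := s) (G := G (n, i, j, s))
    (r := 1 / (m + 1)) (N := n + 1) (ρ := 1 / (n + 1)) hne.some_mem.1 h𝔤 h𝔥 h𝔥d hh hprec.1 hsum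
    (fun e he => he.2.1) (by positivity) (hm.trans_le (gaugePre_antitone 𝔤 ?_ _)) (by positivity)
    (by positivity) (fun e he => he.2.2)
  rw [one_div, ENNReal.ofReal_inv_of_pos (by positivity), ← Nat.cast_succ, ENNReal.ofReal_natCast]
  exact ENNReal.inv_le_inv.2 (by exact_mod_cast m.le_succ)
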